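/- All graphs are finite, simple, undirected and connected. For a graph $G$ on $n$ vertices, $A$ denotes its adjacency matrix, $I$ the identity matrix and $D$ its distance matrix, whose $(u,v)$ entry is the distance $d(u,v)$. The distance spectrum of $G$ is written $\{\lambda_1^{(m_1)},\dots,\lambda_p^{(m_p)}\}$, where $\lambda_1,\dots,\lambda_p$ are the distinct eigenvalues of $D$ and $m_1,\dots,m_p$ are their multiplicities; a multiplicity $1$ is omitted. A $(k,g)$-cage is a $k$-regular graph of girth $g$ with the minimum possible number of vertices. With $d=\lfloor g/2\rfloor$, let $$n_0(k,g)=\begin{cases}1+\sum_{i=0}^{d-1}k(k-1)^i,& g\text{ odd},\\ 1+\sum_{i=0}^{d-2}k(k-1)^i+(k-1)^{d-1},& g\text{ even}.\end{cases}$$ A minimal $(k,g)$-cage is a $(k,g)$-cage with exactly $n_0(k,g)$ vertices. **Theorem.** Let $k\ge 3$, and let $n$ denote the number of vertices of the graph under consideration. 1. The distance matrix of every minimal $(k,5)$-cage is $D=-2kI+A+2A^2$. In particular: (a) for every minimal $(3,5)$-cage, $D=-6I+A+2A^2$ and the distance spectrum is $\{15,\,-3^{(5)},\,0^{(4)}\}$;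 the Petersen graph is a minimal $(3,5)$-cage; (b) for every minimal $(7,5)$-cage, $D=-14I+A+2A^2$ and the distance spectrum is $\{91,\,-4^{(28)},\,1^{(21)}\}$; the Hoffman–Singleton graph is a minimal $(7,5)$-cage; (c) for every minimal $(57,5)$-cage (if one exists), $D=-114I+A+2A^2$ and the distance spectrum is $\{6441,\,-9^{(1729)},\,6^{(1520)}\}$. 2. The distance matrix of every minimal $(k,6)$-cage is $D=\frac3kA^3+2A^2-\frac{5k-3}{k}A-2kI$, and its distance spectrum is $$\{5k^2-7k+3,\ -k^2+3k-3,\ (-2(1+\sqrt{k-1}))^{(m)},\ (-2(1-\sqrt{k-1}))^{(m)}\},\qquad m=\frac{nk(k-1)}{2(k^2-k+1)}.$$ The Heawood graph is a minimal $(3,6)$-cage; for it $D=A^3+2A^2-4A-6I$ and the distance spectrum is $\{27,\,-3,\,(-2(1+\sqrt2))^{(6)},\,(-2(1-\sqrt2))^{(6)}\}$. 3. The distance matrix of every minimal $(k,8)$-cage is $D=\frac4kA^4+3A^3+\frac{8-10k}{k}A^2-(6k-4)A+(2k-4)I$, and its distance spectrum is $$\{7k^3-16k^2+14k-4,\ k^3-4k^2+6k-4,\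 (2k-4)^{(m_0)},\ (-2(k+\sqrt{2(k-1)}))^{(m_1)},\ (-2(k-\sqrt{2(k-1)}))^{(m_1)}\},$$ where $m_0=\frac{n(k-1)}{2k}$ and $m_1=\frac{nk(k-1)}{4(k^2-2k+2)}$. The Levi graph (Tutte–Coxeter graph) is a minimal $(3,8)$-cage; for it $D=\frac43A^4+3A^3-\frac{22}3A^2-14A+2I$ and the distance spectrum is $\{83,\,5,\,2^{(10)},\,-10^{(9)},\,-2^{(9)}\}$. 4. The distance matrix of every minimal $(k,12)$-cage is $$D=\tfrac6kA^6+5A^5+\tfrac{24-26k}{k}A^4-(20k-18)A^3+\tfrac{24k^2-44k+18}{k}A^2+(15k^2-26k+9)A-(2k^2-6k+6)I,$$ and its distance spectrum consists of the simple eigenvalues $11k^5-46k^4+81k^3-72k^2+33k-6$ and $k^5-6k^4+15k^3-20k^2+15k-6$, the eigenvalue $-2k^2+6k-6$ with multiplicity $\frac{n(k-1)}{3k}$, the two eigenvalues $2(k-2)(k\pm\sqrt{k-1})$, each with multiplicity $\frac{nk(k-1)}{4(k^2-k+1)}$, and the two eigenvalues $-2k(k\pm\sqrt{3(k-1)})$,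 each with multiplicity $\frac{nk(k-1)}{12(k^2-3k+3)}$. -/

import Mathlib

open Polynomial

universe u

section Definitions

/-- The distance matrix of a graph. It is used for connected graphs only. -/
noncomputable def distMatrix {V : Type u} (G : SimpleGraph V) : Matrix V V ℝ :=
  Matrix.of fun u v => (G.dist u v : ℝ)

/-- The distance spectrum of `G` is `{λ₁^(m₁), …, λ_p^(m_p)}`, encoded as the list of the pairs
`(λᵢ, mᵢ)`: the `λᵢ` are pairwise distinct, each `mᵢ` is positive, and the `λᵢ` are all the
eigenvalues of the distance matrix, `λᵢ` having multiplicity `mᵢ`. -/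
def HasDistanceSpectrum {V : Type u} [Fintype V] [DecidableEq V] (G : SimpleGraph V)
    (s : List (ℝ × ℕ)) : Prop :=
  (s.map Prod.fst).Nodup ∧ (∀ x ∈ s, 0 < x.2) ∧
    (distMatrix G).charpoly = (s.map fun x => (X - C x.1) ^ x.2).prod

/-- A connected `k`-regular graph of girth `g`. The extended girth is used, so that a graph
without cycles has no girth `g`. -/
structure IsRegularOfGirth {V : Type u} (G : SimpleGraph V) [G.LocallyFinite] (k g : ℕ) :
    Prop where
  connected : G.Connected
  regular : G.IsRegularOfDegree k
  girth_eq : G.egirth = (g : ℕ∞)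

/-- A `(k, g)`-cage: a `k`-regular graph of girth `g` with the least possible number of
vertices. -/
structure IsCage {V : Type u} [Fintype V] (G : SimpleGraph V) [G.LocallyFinite] (k g : ℕ) :
    Prop where
  isRegularOfGirth : IsRegularOfGirth G k g
  card_le : ∀ (n : ℕ) (H : SimpleGraph (Fin n)) [H.LocallyFinite],
    IsRegularOfGirth H k g → Fintype.card V ≤ n

/-- The Moore bound `n₀(k, g)`. With `d = ⌊g/2⌋` it is
`1 + k + k(k-1) + ⋯ + k(k-1)^(d-1)` if `g` is odd, and
`1 + k + k(k-1) + ⋯ + k(k-1)^(d-2) + (k-1)^(d-1)` if `g` is even (for `k ≥ 1`, `g ≥ 2`). -/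
def mooreBound (k g : ℕ) : ℕ :=
  if Odd g then 1 + ∑ i ∈ Finset.range (g / 2), k * (k - 1) ^ i
  else 1 + ∑ i ∈ Finset.range (g / 2 - 1), k * (k - 1) ^ i + (k - 1) ^ (g / 2 - 1)

/-- A minimal `(k, g)`-cage (a Moore graph): a `(k, g)`-cage attaining the Moore bound. -/
structure IsMinimalCage {V : Type u} [Fintype V] (G : SimpleGraph V) [G.LocallyFinite]
    (k g : ℕ) : Prop where
  isCage : IsCage G k g
  card_eq : Fintype.card V = mooreBound k g

/-- The Petersen graph: the vertices are the `2`-subsets of a `5`-set, and two of them are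
adjacent when they are disjoint. -/
def petersenGraph : SimpleGraph {s : Finset (Fin 5) // s.card = 2} where
  Adj s t := Disjoint s.1 t.1
  symm := ⟨fun _ _ h => h.symm⟩
  loopless := ⟨fun s h => by
    have h0 : s.1 = ∅ := by simpa using h
    have h1 := s.2
    rw [h0] at h1
    simp at h1⟩

instance : DecidableRel petersenGraph.Adj :=
  fun s t => inferInstanceAs (Decidable (Disjoint s.1 t.1))

/-- The adjacency relation of the Hoffman–Singleton graph, in the pentagon-pentagram form.
`Sum.inl (h, j)` is the vertex `j` of the pentagon `P_h`, `Sum.inr (i, j)` is the vertex `j` of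
the pentagram `Q_i`, and the vertex `j` of `P_h` is joined to the vertex `h * i + j` of `Q_i`. -/
def hoffmanSingletonAdj : (ZMod 5 × ZMod 5) ⊕ (ZMod 5 × ZMod 5) →
    (ZMod 5 × ZMod 5) ⊕ (ZMod 5 × ZMod 5) → Prop
  | Sum.inl p, Sum.inl q => p.1 = q.1 ∧ (q.2 = p.2 + 1 ∨ p.2 = q.2 + 1)
  | Sum.inr p, Sum.inr q => p.1 = q.1 ∧ (q.2 = p.2 + 2 ∨ p.2 = q.2 + 2)
  | Sum.inl p, Sum.inr q => q.2 = p.1 * q.1 + p.2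
  | Sum.inr p, Sum.inl q => p.2 = q.1 * p.1 + q.2

instance : DecidableRel hoffmanSingletonAdj
  | Sum.inl _, Sum.inl _ => inferInstanceAs (Decidable (_ ∧ (_ ∨ _)))
  | Sum.inr _, Sum.inr _ => inferInstanceAs (Decidable (_ ∧ (_ ∨ _)))
  | Sum.inl _, Sum.inr _ => inferInstanceAs (Decidable (_ = _))
  | Sum.inr _, Sum.inl _ => inferInstanceAs (Decidable (_ = _))

/-- The Hoffman–Singleton graph. -/
def hoffmanSingletonGraph : SimpleGraph ((ZMod 5 × ZMod 5) ⊕ (ZMod 5 × ZMod 5)) where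
  Adj := hoffmanSingletonAdj
  symm := ⟨by
    rintro (p | p) (q | q) h
    · exact ⟨h.1.symm, h.2.symm⟩
    · exact h
    · exact h
    · exact ⟨h.1.symm, h.2.symm⟩⟩
  loopless := ⟨by
    have h1 : ∀ b : ZMod 5, ¬ (b = b + 1 ∨ b = b + 1) := by decide
    have h2 : ∀ b : ZMod 5, ¬ (b = b + 2 ∨ b = b + 2) := by decide
    rintro (p | p) h
    · exact h1 p.2 h.2
    · exact h2 p.2 h.2⟩

instance : DecidableRel hoffmanSingletonGraph.Adj :=
  inferInstanceAs (DecidableRel hoffmanSingletonAdj)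

/-- The bipartite incidence graph (Levi graph) of a relation between points and lines. -/
def incidenceGraph {P L : Type} (I : P → L → Prop) : SimpleGraph (P ⊕ L) where
  Adj
    | Sum.inl p, Sum.inr l => I p l
    | Sum.inr l, Sum.inl p => I p l
    | _, _ => False
  symm := ⟨by rintro (_ | _) (_ | _) h <;> exact h⟩
  loopless := ⟨by rintro (_ | _) h <;> exact h⟩

instance {P L : Type} (I : P → L → Prop) [∀ p l, Decidable (I p l)] :
    DecidableRel (incidenceGraph I).Adj
  | Sum.inl p, Sum.inr l => inferInstanceAs (Decidable (I p l))
  | Sum.inr l, Sum.inl p => inferInstanceAs (Decidable (I p l))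
  | Sum.inl _, Sum.inl _ => inferInstanceAs (Decidable False)
  | Sum.inr _, Sum.inr _ => inferInstanceAs (Decidable False)

/-- The Heawood graph: the incidence graph of the Fano plane, whose points are the residues
modulo `7` and whose lines are the seven translates `l + {0, 1, 3}`. -/
abbrev heawoodGraph : SimpleGraph (ZMod 7 ⊕ ZMod 7) :=
  incidenceGraph fun p l : ZMod 7 => p = l ∨ p = l + 1 ∨ p = l + 3

/-- The Levi graph (Tutte–Coxeter graph): the incidence graph between the `15` two-element subsets
of a `6`-set and the `15` partitions of the `6`-set into three pairs. Such a partition is given by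
the involution without fixed points that exchanges the elements of each pair, so that a
two-element subset belongs to the partition when the involution preserves it. -/
abbrev leviGraph : SimpleGraph ({s : Finset (Fin 6) // s.card = 2} ⊕
    {σ : Equiv.Perm (Fin 6) // ∀ x, σ x ≠ x ∧ σ (σ x) = x}) :=
  incidenceGraph fun s σ => s.1.image σ.1 = s.1

end Definitions

/-!
Everything follows from one fact about short distances: two distinct paths with the same endpoints
contain a cycle, so that the girth is at most the sum of their lengths
(`SimpleGraph.egirth_le_length_add_length`). Hence below half the girth a vertex has exactly one
neighbour closer to a given vertex and no neighbour at the same distance, all others being farther.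
Spheres therefore have the size they have in the `k`-regular tree, which gives the Moore bound
(`SimpleGraph.mooreBound_le_card`). A `k`-regular graph of girth at least `g` that attains the
bound is a minimal cage (`IsMinimalCage.of_le_egirth`): balls exhaust it, so it is connected, and
a larger girth would force more vertices. For the named graphs it thus suffices to exclude short
cycles.

Let `Aᵢ` be the `0`-`1` matrix of the pairs at distance `i`. The same local counts give the
recurrence `A Aᵢ = Aᵢ₊₁ + (k - 1) Aᵢ₋₁` below half the girth, with `k` in place of `k - 1` for
`i = 1`, so that `Aᵢ` is a polynomial in the adjacency matrix `A`. In a minimal cage of odd girth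
`2 d + 1` the `Aᵢ` with `i ≤ d` exhaust all pairs. In a minimal cage of girth `2 d` every vertex is
within distance `d - 1` of an endpoint of each edge; hence the diameter is `d` and all `k`
neighbours of a vertex at distance `d` are closer, so that `k A_d = A A_{d-1} - (k - 1) A_{d-2}`. In
both cases `D = ∑ i Aᵢ` is an explicit polynomial in `A` (`distMatrix_eq_aeval`).

Finally `∑ Aᵢ` is the all-ones matrix `J` and `A J = k J`, which yields a polynomial with simple
real roots that annihilates the symmetric matrix `A`. Its roots are the only possible eigenvalues,
and since `Aᵢ` has trace `0` for `i ≥ 1`, their multiplicities satisfy a linear system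
(`distMatrix_of_layer_polynomials`) that has one solution. Evaluating the polynomial of `D` at these
roots gives the distance spectrum.
-/

/-! ### Girth and geodesics -/

namespace SimpleGraph

variable {V : Type u} {G : SimpleGraph V}

/-- Two distinct paths with common endpoints contain a cycle that uses only their edges, which
bounds the girth by the sum of their lengths. -/
theorem egirth_le_length_add_length {u v : V} {p q : G.Walk u v} (hp : p.IsPath)
    (hq : q.IsPath) (hne : p ≠ q) : G.egirth ≤ ((p.length + q.length : ℕ) : ℕ∞) := by
  classical
  set s : Set (Sym2 V) := {e | e ∈ p.edges ∨ e ∈ q.edges} with hs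
  set H : SimpleGraph V := fromEdgeSet s with hH
  have hle : H ≤ G := by
    intro a b hab
    rw [hH, fromEdgeSet_adj] at hab
    rcases hab.1 with h | h
    · exact p.adj_of_mem_edges h
    · exact q.adj_of_mem_edges h
  have hpe : ∀ e ∈ p.edges, e ∈ H.edgeSet := by
    intro e he
    rw [hH, edgeSet_fromEdgeSet]
    exact ⟨Or.inl he, G.not_isDiag_of_mem_edgeSet (p.edges_subset_edgeSet he)⟩
  have hqe : ∀ e ∈ q.edges, e ∈ H.edgeSet := by
    intro e he
    rw [hH, edgeSet_fromEdgeSet]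
    exact ⟨Or.inr he, G.not_isDiag_of_mem_edgeSet (q.edges_subset_edgeSet he)⟩
  have hcyc : ¬ H.IsAcyclic := by
    intro hac
    have hpq := (hac.subsingleton_path u v).elim ⟨p.transfer H hpe, hp.transfer hpe⟩
      ⟨q.transfer H hqe, hq.transfer hqe⟩
    have hsupp := congrArg (fun r : H.Path u v => r.1.support) hpq
    simp only [Walk.support_transfer] at hsupp
    exact hne (Walk.ext_support hsupp)
  unfold IsAcyclic at hcyc
  push Not at hcyc
  obtain ⟨a, c, hc⟩ := hcyc
  refine (egirth_anti hle).trans ((egirth_le_length hc).trans ?_)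
  have hsub : c.edges ⊆ p.edges ++ q.edges := by
    intro e he
    have h1 := c.edges_subset_edgeSet he
    rw [hH, edgeSet_fromEdgeSet] at h1
    exact List.mem_append.2 h1.1
  have hlen := (List.subperm_of_subset hc.edges_nodup hsub).length_le
  rw [List.length_append, Walk.length_edges, Walk.length_edges, Walk.length_edges] at hlen
  exact_mod_cast hlen

/-- A walk as short as the distance of its endpoints is a path. -/
theorem Walk.isPath_of_length_eq_edist {u v : V} (p : G.Walk u v)
    (hp : (p.length : ℕ∞) = G.edist u v) : p.IsPath := by
  apply p.isPath_of_length_eq_dist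
  rw [← p.reachable.coe_dist_eq_edist] at hp
  exact_mod_cast hp

/-- Along an edge the distance to a fixed vertex grows by at most one. -/
theorem Adj.edist_le_succ {v w : V} (h : G.Adj v w) {u : V} {i : ℕ} (hi : G.edist v u = i) :
    G.edist w u ≤ ((i + 1 : ℕ) : ℕ∞) := by
  have h1 := G.edist_triangle (u := w) (v := v) (w := u)
  rw [hi, edist_eq_one_iff_adj.2 h.symm] at h1
  rw [add_comm] at h1
  exact_mod_cast h1

/-- Below half the girth, every vertex has only one neighbour closer to a given vertex. -/
theorem eq_of_adj_of_edist_eq {i : ℕ} (hg : ((2 * (i + 1) : ℕ) : ℕ∞) < G.egirth) {u v w₁ w₂ : V}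
    (huv : G.edist v u = ((i + 1 : ℕ) : ℕ∞)) (h₁ : G.Adj v w₁) (h₂ : G.Adj v w₂)
    (e₁ : G.edist w₁ u = i) (e₂ : G.edist w₂ u = i) : w₁ = w₂ := by
  by_contra hne
  obtain ⟨p₁, hp₁⟩ := exists_walk_of_edist_eq_coe e₁
  obtain ⟨p₂, hp₂⟩ := exists_walk_of_edist_eq_coe e₂
  have l₁ : (Walk.cons h₁ p₁).length = i + 1 := by simp [hp₁]
  have l₂ : (Walk.cons h₂ p₂).length = i + 1 := by simp [hp₂]
  have := egirth_le_length_add_length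
    ((Walk.cons h₁ p₁).isPath_of_length_eq_edist (by rw [l₁, huv]))
    ((Walk.cons h₂ p₂).isPath_of_length_eq_edist (by rw [l₂, huv]))
    (by
      intro h
      exact hne (by simpa using congrArg Walk.snd h))
  rw [l₁, l₂, ← two_mul] at this
  exact absurd this (not_le.2 hg)

/-- Below half the girth, adjacent vertices have different distances to a given vertex. -/
theorem not_adj_of_edist_eq {i : ℕ} (hg : ((2 * i + 1 : ℕ) : ℕ∞) < G.egirth) {u v w : V}
    (hv : G.edist v u = i) (hw : G.edist w u = i) : ¬ G.Adj v w := by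
  classical
  intro hvw
  obtain ⟨p, hp⟩ := exists_walk_of_edist_eq_coe hv
  obtain ⟨q, hq⟩ := exists_walk_of_edist_eq_coe hw
  have hpp := p.isPath_of_length_eq_edist (by rw [hp, hv])
  have hqp := q.isPath_of_length_eq_edist (by rw [hq, hw])
  have hmem : v ∉ q.support := by
    intro hmem
    have h1 : (i : ℕ∞) ≤ (q.dropUntil v hmem).length := hv ▸ edist_le _
    have h2 : i ≤ (q.dropUntil v hmem).length := by exact_mod_cast h1
    have h3 : (q.takeUntil v hmem).length + (q.dropUntil v hmem).length = i := by
      rw [← Walk.length_append, Walk.take_spec, hq]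
    exact hvw.ne' (Walk.eq_of_length_eq_zero (p := q.takeUntil v hmem) (by omega))
  have := egirth_le_length_add_length hpp (hqp.cons hmem (h := hvw)) (by
    intro h
    have := congrArg Walk.length h
    simp [hp, hq] at this)
  rw [Walk.length_cons, hp, hq] at this
  refine absurd this (not_le.2 ?_)
  rwa [show i + (i + 1) = 2 * i + 1 by omega]

end SimpleGraph

/-! ### Spheres, balls and the Moore bound -/

namespace SimpleGraph

variable {V : Type u} {G : SimpleGraph V}

theorem le_edist_of_adj {v w u : V} {i : ℕ} (h : G.Adj v w)
    (hi : G.edist v u = ((i + 1 : ℕ) : ℕ∞)) : (i : ℕ∞) ≤ G.edist w u := by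
  by_contra hlt
  rw [not_le] at hlt
  obtain ⟨j, hj⟩ := ENat.ne_top_iff_exists.1 hlt.ne_top
  have h1 := h.symm.edist_le_succ hj.symm
  rw [hi] at h1
  rw [← hj] at hlt
  have h2 : i + 1 ≤ j + 1 := by exact_mod_cast h1
  have h3 : j < i := by exact_mod_cast hlt
  omega

theorem exists_adj_of_edist_eq_succ {v u : V} {i : ℕ} (hi : G.edist v u = ((i + 1 : ℕ) : ℕ∞)) :
    ∃ w, G.Adj v w ∧ G.edist w u = i := by
  obtain ⟨p, hp⟩ := exists_walk_of_edist_eq_coe hi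
  cases p with
  | nil => simp at hp
  | cons h p =>
    refine ⟨_, h, le_antisymm ?_ (le_edist_of_adj h hi)⟩
    have := edist_le p
    simp only [Walk.length_cons, Nat.add_right_cancel_iff] at hp
    rwa [hp] at this

/-- Below half the girth, the neighbours of `v` are one step closer to or one step farther from
`u` than `v` is. -/
theorem edist_eq_succ_or_of_adj {i : ℕ} (hg : ((2 * i + 1 : ℕ) : ℕ∞) < G.egirth) {u v w : V}
    (hv : G.edist v u = i) (h : G.Adj v w) :
    G.edist w u = ((i + 1 : ℕ) : ℕ∞) ∨ ∃ j, i = j + 1 ∧ G.edist w u = j := by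
  have h1 := h.edist_le_succ hv
  obtain ⟨j, hj⟩ := ENat.ne_top_iff_exists.1 (ne_top_of_le_ne_top (ENat.natCast_ne_top _) h1)
  rw [← hj] at h1 ⊢
  have h2 : j ≤ i + 1 := by exact_mod_cast h1
  have h3 : j ≠ i := by
    rintro rfl
    exact not_adj_of_edist_eq hg hv hj.symm h
  have h4 := h.symm.edist_le_succ hj.symm
  rw [hv] at h4
  have h5 : i ≤ j + 1 := by exact_mod_cast h4
  rcases Nat.lt_or_ge i j with h6 | h6
  · left
    rw [show j = i + 1 by omega]
  · right
    exact ⟨j, by omega, rfl⟩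

variable [Fintype V]

theorem card_sphere_zero (u : V) : (Finset.univ.filter fun x => G.edist x u = 0).card = 1 := by
  rw [Finset.card_eq_one]
  exact ⟨u, by ext x; simp [edist_eq_zero_iff]⟩

variable [DecidableRel G.Adj]

theorem card_neighborFinset_closer {i : ℕ} (hg : ((2 * (i + 1) : ℕ) : ℕ∞) < G.egirth) {u v : V}
    (hv : G.edist v u = ((i + 1 : ℕ) : ℕ∞)) :
    ((G.neighborFinset v).filter fun w => G.edist w u = i).card = 1 := by
  obtain ⟨w, hw, he⟩ := exists_adj_of_edist_eq_succ hv
  rw [Finset.card_eq_one]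
  refine ⟨w, ?_⟩
  ext x
  simp only [Finset.mem_filter, mem_neighborFinset, Finset.mem_singleton]
  constructor
  · rintro ⟨h1, h2⟩
    exact eq_of_adj_of_edist_eq hg hv h1 hw h2 he
  · rintro rfl
    exact ⟨hw, he⟩

theorem card_neighborFinset_farther_zero {k : ℕ} (hreg : G.IsRegularOfDegree k) {u v : V}
    (hv : G.edist v u = 0) :
    ((G.neighborFinset v).filter fun w => G.edist w u = ((1 : ℕ) : ℕ∞)).card = k := by
  rw [edist_eq_zero_iff] at hv
  subst hv
  rw [Finset.filter_true_of_mem]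
  · exact hreg v
  · intro w hw
    rw [mem_neighborFinset] at hw
    exact_mod_cast edist_eq_one_iff_adj.2 hw.symm

theorem card_neighborFinset_farther {k : ℕ} (hreg : G.IsRegularOfDegree k) {i : ℕ}
    (hg : ((2 * (i + 1) + 1 : ℕ) : ℕ∞) < G.egirth) {u v : V}
    (hv : G.edist v u = ((i + 1 : ℕ) : ℕ∞)) :
    ((G.neighborFinset v).filter fun w => G.edist w u = ((i + 2 : ℕ) : ℕ∞)).card = k - 1 := by
  have h1 := card_neighborFinset_closer (lt_trans (by exact_mod_cast Nat.lt_succ_self _) hg) hv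
  have h2 : ((G.neighborFinset v).filter fun w => G.edist w u = ((i + 2 : ℕ) : ℕ∞)) =
      (G.neighborFinset v).filter fun w => ¬ G.edist w u = i := by
    apply Finset.filter_congr
    intro w hw
    rw [mem_neighborFinset] at hw
    constructor
    · intro h h'
      rw [h] at h'
      have : i + 2 = i := by exact_mod_cast h'
      omega
    · intro h
      rcases edist_eq_succ_or_of_adj hg hv hw with h' | ⟨j, hj, h'⟩
      · exact h'
      · exact absurd (by rw [h']; congr 1; omega) h
  have h3 := Finset.card_filter_add_card_filter_not (s := G.neighborFinset v)
    (fun w => G.edist w u = i)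
  rw [card_neighborFinset_eq_degree, hreg v] at h3
  rw [h2]
  omega

theorem card_sphere_mul {i m : ℕ} (hg : ((2 * (i + 1) : ℕ) : ℕ∞) < G.egirth) (u : V)
    (hm : ∀ v, G.edist v u = i →
      ((G.neighborFinset v).filter fun w => G.edist w u = ((i + 1 : ℕ) : ℕ∞)).card = m) :
    (Finset.univ.filter fun x => G.edist x u = i).card * m =
      (Finset.univ.filter fun x => G.edist x u = ((i + 1 : ℕ) : ℕ∞)).card := by
  have := Finset.card_mul_eq_card_mul (s := Finset.univ.filter fun x => G.edist x u = i)
    (t := Finset.univ.filter fun x => G.edist x u = ((i + 1 : ℕ) : ℕ∞)) (m := m) (n := 1) G.Adj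
    (by
      intro a ha
      rw [← hm a (by simpa using ha)]
      congr 1
      ext w
      simp [Finset.mem_bipartiteAbove, and_comm])
    (by
      intro b hb
      rw [← card_neighborFinset_closer hg (u := u) (v := b) (by simpa using hb)]
      congr 1
      ext w
      simp [Finset.mem_bipartiteBelow, and_comm, G.adj_comm])
  rwa [mul_one] at this

/-- Below half the girth, spheres are as large as in the `k`-regular tree. -/
theorem card_sphere {k : ℕ} (hreg : G.IsRegularOfDegree k) (u : V) {i : ℕ}
    (hg : ((2 * (i + 1) : ℕ) : ℕ∞) < G.egirth) :
    (Finset.univ.filter fun x => G.edist x u = ((i + 1 : ℕ) : ℕ∞)).card = k * (k - 1) ^ i := by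
  induction i with
  | zero =>
    rw [← card_sphere_mul (i := 0) (m := k) hg u
      fun v hv => card_neighborFinset_farther_zero hreg (by exact_mod_cast hv)]
    have := card_sphere_zero (G := G) u
    push_cast
    rw [this]
    simp
  | succ i ih =>
    have hlt : ((2 * (i + 1) + 1 : ℕ) : ℕ∞) < G.egirth :=
      lt_trans (by exact_mod_cast (by omega : 2 * (i + 1) + 1 < 2 * (i + 1 + 1))) hg
    rw [← card_sphere_mul hg u fun v hv => card_neighborFinset_farther hreg hlt hv,
      ih (lt_trans (by exact_mod_cast Nat.lt_succ_self _) hlt), pow_succ, mul_assoc]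

/-- Below half the girth, balls are as large as in the `k`-regular tree. -/
theorem card_ball {k : ℕ} (hreg : G.IsRegularOfDegree k) (u : V) {d : ℕ}
    (hg : ((2 * d : ℕ) : ℕ∞) < G.egirth) :
    (Finset.univ.filter fun x => G.edist x u ≤ d).card =
      1 + ∑ i ∈ Finset.range d, k * (k - 1) ^ i := by
  classical
  induction d with
  | zero => simpa using card_sphere_zero (G := G) u
  | succ d ih =>
    have hlt : ((2 * d : ℕ) : ℕ∞) < G.egirth :=
      lt_trans (by exact_mod_cast (by omega : 2 * d < 2 * (d + 1))) hg
    rw [Finset.sum_range_succ, ← add_assoc, ← ih hlt, ← card_sphere hreg u hg,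
      ← Finset.card_union_of_disjoint]
    · congr 1
      ext x
      simp only [Finset.mem_filter, Finset.mem_univ, true_and, Finset.mem_union]
      rw [le_iff_lt_or_eq]
      apply or_congr_left
      push_cast
      exact ENat.lt_natCast_add_one_iff
    · rw [Finset.disjoint_filter]
      intro x _ h1 h2
      rw [h2] at h1
      have : d + 1 ≤ d := by exact_mod_cast h1
      omega

/-- The vertices at distance `i` from `u` that lie on the side of `u` of the edge `uv`. -/
theorem card_half_sphere {k : ℕ} (hreg : G.IsRegularOfDegree k) {u v : V} (huv : G.Adj u v)
    {i : ℕ} (hg : ((2 * i + 1 : ℕ) : ℕ∞) < G.egirth) :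
    (Finset.univ.filter fun x =>
      G.edist x u = i ∧ G.edist x v = ((i + 1 : ℕ) : ℕ∞)).card = (k - 1) ^ i := by
  classical
  induction i generalizing u v with
  | zero =>
    rw [pow_zero, Finset.card_eq_one]
    refine ⟨u, ?_⟩
    ext x
    simp only [Finset.mem_filter, Finset.mem_univ, true_and, Finset.mem_singleton,
      Nat.cast_zero, edist_eq_zero_iff]
    constructor
    · exact fun h => h.1
    · rintro rfl
      exact ⟨rfl, by exact_mod_cast edist_eq_one_iff_adj.2 huv⟩
  | succ i ih =>
    have hlt : ((2 * i + 1 : ℕ) : ℕ∞) < G.egirth :=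
      lt_trans (by exact_mod_cast (by omega : 2 * i + 1 < 2 * (i + 1) + 1)) hg
    have h1 := ih huv.symm hlt
    have h2 := card_sphere hreg u (i := i) (lt_trans (by exact_mod_cast Nat.lt_succ_self _) hg)
    have h3 : (Finset.univ.filter fun x => G.edist x u = ((i + 1 : ℕ) : ℕ∞)) =
        (Finset.univ.filter fun x =>
          G.edist x u = ((i + 1 : ℕ) : ℕ∞) ∧ G.edist x v = ((i + 1 + 1 : ℕ) : ℕ∞)) ∪
        (Finset.univ.filter fun x =>
          G.edist x v = i ∧ G.edist x u = ((i + 1 : ℕ) : ℕ∞)) := by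
      ext x
      simp only [Finset.mem_filter, Finset.mem_univ, true_and, Finset.mem_union]
      constructor
      · intro h
        rcases edist_eq_succ_or_of_adj hg (u := x) (edist_comm.trans h) huv with h' | ⟨j, hj, h'⟩
        · exact Or.inl ⟨h, edist_comm.trans h'⟩
        · exact Or.inr ⟨by rw [edist_comm, h']; congr 1; omega, h⟩
      · rintro (h | h)
        · exact h.1
        · exact h.2
    rw [h3, Finset.card_union_of_disjoint, h1] at h2
    · have hk : 0 < k := by
        rw [← hreg u, ← card_neighborFinset_eq_degree, Finset.card_pos]
        exact ⟨v, by simpa using huv⟩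
      obtain ⟨k, rfl⟩ : ∃ l, k = l + 1 := ⟨k - 1, by omega⟩
      simp only [Nat.add_sub_cancel] at h2 ⊢
      rw [pow_succ]
      linarith [mul_comm k (k ^ i)]
    · rw [Finset.disjoint_filter]
      rintro x _ ⟨-, h4⟩ ⟨h5, -⟩
      rw [h4] at h5
      have : i + 1 + 1 = i := by exact_mod_cast h5
      omega

end SimpleGraph

theorem mooreBound_odd (k d : ℕ) :
    mooreBound k (2 * d + 1) = 1 + ∑ i ∈ Finset.range d, k * (k - 1) ^ i := by
  rw [mooreBound, if_pos (odd_two_mul_add_one d), show (2 * d + 1) / 2 = d by omega]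

theorem mooreBound_even (k d : ℕ) :
    mooreBound k (2 * d + 2) = 1 + ∑ i ∈ Finset.range d, k * (k - 1) ^ i + (k - 1) ^ d := by
  rw [mooreBound, if_neg (by rw [Nat.not_odd_iff_even]; exact ⟨d + 1, by ring⟩),
    show (2 * d + 2) / 2 - 1 = d by omega]

theorem mooreBound_lt_succ {k : ℕ} (hk : 2 ≤ k) (g : ℕ) (hg : 1 ≤ g) :
    mooreBound k g < mooreBound k (g + 1) := by
  have hpos : ∀ d, 0 < (k - 1) ^ d := fun d => pow_pos (by omega) d
  rcases Nat.even_or_odd' g with ⟨d, rfl | rfl⟩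
  · obtain ⟨d, rfl⟩ : ∃ e, d = e + 1 := ⟨d - 1, by omega⟩
    rw [show 2 * (d + 1) = 2 * d + 2 by ring, mooreBound_even,
      show 2 * d + 2 + 1 = 2 * (d + 1) + 1 by ring, mooreBound_odd, Finset.sum_range_succ]
    nlinarith [hpos d]
  · rw [mooreBound_odd, mooreBound_even]
    exact Nat.lt_add_of_pos_right (hpos d)

namespace SimpleGraph

variable {V : Type u} {G : SimpleGraph V}

theorem IsRegularOfDegree.exists_adj [G.LocallyFinite] {k : ℕ} (hreg : G.IsRegularOfDegree k)
    (hk : 1 ≤ k) (u : V) : ∃ v, G.Adj u v := by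
  rw [← G.degree_pos_iff_exists_adj u, hreg u]
  exact hk

variable [Fintype V] [DecidableRel G.Adj]

/-- The vertices within distance `d` of an endpoint of an edge number `mooreBound k (2 * d + 2)`. -/
theorem card_edge_ball [DecidableEq V] {k : ℕ} (hreg : G.IsRegularOfDegree k) {u v : V}
    (huv : G.Adj u v) {d : ℕ} (hg : ((2 * d + 1 : ℕ) : ℕ∞) < G.egirth) :
    ((Finset.univ.filter fun x => G.edist x u ≤ d) ∪ Finset.univ.filter fun x =>
      G.edist x v = d ∧ G.edist x u = ((d + 1 : ℕ) : ℕ∞)).card = mooreBound k (2 * d + 2) := by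
  rw [Finset.card_union_of_disjoint, card_half_sphere hreg huv.symm hg,
    card_ball hreg u (lt_trans (by exact_mod_cast Nat.lt_succ_self _) hg), mooreBound_even]
  rw [Finset.disjoint_filter]
  rintro x _ h1 ⟨-, h2⟩
  rw [h2] at h1
  have : d + 1 ≤ d := by exact_mod_cast h1
  omega

/-- The Moore bound. It needs no connectedness. -/
theorem mooreBound_le_card [Nonempty V] {k g : ℕ} (hk : 1 ≤ k) (hg1 : 1 ≤ g)
    (hreg : G.IsRegularOfDegree k) (hg : (g : ℕ∞) ≤ G.egirth) :
    mooreBound k g ≤ Fintype.card V := by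
  classical
  obtain ⟨u⟩ := ‹Nonempty V›
  rcases Nat.even_or_odd' g with ⟨d, rfl | rfl⟩
  · obtain ⟨d, rfl⟩ : ∃ e, d = e + 1 := ⟨d - 1, by omega⟩
    obtain ⟨v, huv⟩ := hreg.exists_adj hk u
    rw [show 2 * (d + 1) = 2 * d + 2 by ring, ← card_edge_ball hreg huv
      (lt_of_lt_of_le (by exact_mod_cast (by omega : 2 * d + 1 < 2 * (d + 1))) hg)]
    exact Finset.card_le_univ _
  · rw [mooreBound_odd, ← card_ball hreg u
      (lt_of_lt_of_le (by exact_mod_cast Nat.lt_succ_self _) hg)]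
    exact Finset.card_le_univ _

theorem edist_le_of_card_eq_mooreBound {k d : ℕ} (hreg : G.IsRegularOfDegree k)
    (hg : ((2 * d + 1 : ℕ) : ℕ∞) ≤ G.egirth) (hc : Fintype.card V = mooreBound k (2 * d + 1))
    (x u : V) : G.edist x u ≤ d := by
  have h := card_ball hreg u (lt_of_lt_of_le (by exact_mod_cast Nat.lt_succ_self _) hg)
  rw [← mooreBound_odd, ← hc, Finset.card_eq_iff_eq_univ] at h
  simpa using h.ge (Finset.mem_univ x)

theorem edist_le_or_of_card_eq_mooreBound {k d : ℕ} (hreg : G.IsRegularOfDegree k)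
    (hg : ((2 * d + 2 : ℕ) : ℕ∞) ≤ G.egirth) (hc : Fintype.card V = mooreBound k (2 * d + 2))
    {u v : V} (huv : G.Adj u v) (x : V) : G.edist x u ≤ d ∨ G.edist x v ≤ d := by
  classical
  have h := card_edge_ball hreg huv (lt_of_lt_of_le (by exact_mod_cast Nat.lt_succ_self _) hg)
  rw [← hc, Finset.card_eq_iff_eq_univ] at h
  have hx := h.ge (Finset.mem_univ x)
  simp only [Finset.mem_union, Finset.mem_filter, Finset.mem_univ, true_and] at hx
  rcases hx with hx | hx
  · exact Or.inl hx
  · exact Or.inr hx.1.le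

theorem connected_of_card_eq_mooreBound [Nonempty V] {k g : ℕ} (hk : 1 ≤ k) (hg1 : 1 ≤ g)
    (hreg : G.IsRegularOfDegree k) (hg : (g : ℕ∞) ≤ G.egirth)
    (hc : Fintype.card V = mooreBound k g) : G.Connected := by
  refine ⟨fun x u => ?_⟩
  rcases Nat.even_or_odd' g with ⟨d, rfl | rfl⟩
  · obtain ⟨d, rfl⟩ : ∃ e, d = e + 1 := ⟨d - 1, by omega⟩
    obtain ⟨v, huv⟩ := hreg.exists_adj hk u
    rcases edist_le_or_of_card_eq_mooreBound hreg hg hc huv x with h | h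
    · exact reachable_of_edist_ne_top (ne_top_of_le_ne_top (ENat.natCast_ne_top _) h)
    · exact (reachable_of_edist_ne_top (ne_top_of_le_ne_top (ENat.natCast_ne_top _) h)).trans
        huv.symm.reachable
  · exact reachable_of_edist_ne_top (ne_top_of_le_ne_top (ENat.natCast_ne_top _)
      (edist_le_of_card_eq_mooreBound hreg hg hc x u))

end SimpleGraph

open SimpleGraph in
/-- A `k`-regular graph of girth at least `g` that attains the Moore bound is a minimal cage: a
larger girth would force more vertices, and balls exhaust the graph, so that it is connected. -/
theorem IsMinimalCage.of_le_egirth {V : Type u} [Fintype V] [Nonempty V] {G : SimpleGraph V}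
    [DecidableRel G.Adj] {k g : ℕ} (hk : 2 ≤ k) (hg1 : 1 ≤ g) (hreg : G.IsRegularOfDegree k)
    (hg : (g : ℕ∞) ≤ G.egirth) (hc : Fintype.card V = mooreBound k g) : IsMinimalCage G k g := by
  refine ⟨⟨⟨connected_of_card_eq_mooreBound (by omega) hg1 hreg hg hc, hreg, ?_⟩, ?_⟩, hc⟩
  · refine le_antisymm ?_ hg
    by_contra hlt
    rw [not_le] at hlt
    have h1 := mooreBound_le_card (k := k) (g := g + 1) (by omega) (by omega) hreg
      (by push_cast; exact Order.add_one_le_of_lt hlt)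
    have h2 := mooreBound_lt_succ hk g hg1
    omega
  · intro n H _ hH
    classical
    have := hH.connected.nonempty
    rw [hc]
    refine (mooreBound_le_card (G := H) (by omega) hg1 ?_ hH.girth_eq.ge).trans_eq
      (Fintype.card_fin n)
    convert hH.regular

/-! ### Polynomials in a symmetric matrix -/

section Spectrum

variable {V : Type u} [Fintype V] [DecidableEq V] {A : Matrix V V ℝ}

theorem Matrix.IsHermitian.aeval_eq_conj_diagonal (hA : A.IsHermitian) (f : ℝ[X]) :
    aeval A f = Unitary.conjStarAlgAut ℝ _ hA.eigenvectorUnitary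
      (Matrix.diagonal fun i => f.eval (hA.eigenvalues i)) := by
  have h : Matrix.diagonal (fun i => f.eval (hA.eigenvalues i)) =
      aeval (Matrix.diagonal hA.eigenvalues) f := by
    have h1 := aeval_algHom_apply (Matrix.diagonalAlgHom (n := V) (α := ℝ) ℝ) hA.eigenvalues f
    rw [Matrix.diagonalAlgHom_apply] at h1
    rw [h1, Matrix.diagonalAlgHom_apply]
    congr 1
    ext i
    exact (aeval_fn_apply f hA.eigenvalues i).symm ▸ rfl
  have h2 := aeval_algHom_apply
    ((Unitary.conjStarAlgAut ℝ (Matrix V V ℝ) hA.eigenvectorUnitary).toAlgEquiv :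
      Matrix V V ℝ →ₐ[ℝ] Matrix V V ℝ) (Matrix.diagonal hA.eigenvalues) f
  rw [h]
  conv_lhs => rw [hA.spectral_theorem]
  exact h2

theorem Matrix.IsHermitian.charpoly_aeval (hA : A.IsHermitian) (f : ℝ[X]) :
    (aeval A f).charpoly = ∏ i, (X - C (f.eval (hA.eigenvalues i))) := by
  rw [hA.aeval_eq_conj_diagonal, Unitary.conjStarAlgAut_apply, Matrix.charpoly_mul_comm,
    ← mul_assoc]
  simp [Matrix.charpoly_diagonal]

theorem Matrix.IsHermitian.trace_aeval (hA : A.IsHermitian) (f : ℝ[X]) :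
    (aeval A f).trace = ∑ i, f.eval (hA.eigenvalues i) := by
  rw [hA.aeval_eq_conj_diagonal, Unitary.conjStarAlgAut_apply, Matrix.trace_mul_comm, ← mul_assoc]
  simp [Matrix.trace_diagonal]

/-- If a real symmetric matrix `A` is annihilated by `∏ (X - t)`, where `t` runs over a list of
distinct reals, then there are multiplicities for these reals that give the characteristic
polynomial and the trace of every polynomial in `A`. -/
theorem Matrix.IsHermitian.exists_multiplicity (hA : A.IsHermitian) {L : List ℝ} (hL : L.Nodup)
    (h : aeval A (L.map fun t => X - C t).prod = 0) :
    ∃ m : ℝ → ℕ, ∀ f : ℝ[X],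
      (aeval A f).charpoly = (L.map fun t => (X - C (f.eval t)) ^ m t).prod ∧
      (aeval A f).trace = (L.map fun t => m t * f.eval t).sum := by
  have hmem : ∀ i ∈ (Finset.univ : Finset V), hA.eigenvalues i ∈ L.toFinset := by
    intro i _
    rw [hA.aeval_eq_conj_diagonal, map_eq_zero_iff _ (EquivLike.injective _)] at h
    have h1 := congrFun (congrFun h i) i
    rw [Matrix.diagonal_apply_eq, eval_list_prod, Matrix.zero_apply, List.prod_eq_zero_iff] at h1
    simp only [List.map_map, List.mem_map, Function.comp_apply, eval_sub, eval_X, eval_C] at h1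
    obtain ⟨t, ht, h2⟩ := h1
    rw [sub_eq_zero.1 h2]
    exact List.mem_toFinset.2 ht
  refine ⟨fun t => (Finset.univ.filter fun i => hA.eigenvalues i = t).card, fun f => ⟨?_, ?_⟩⟩
  · rw [hA.charpoly_aeval, ← Finset.prod_fiberwise_of_maps_to hmem, ← List.prod_toFinset _ hL]
    refine Finset.prod_congr rfl fun t _ => ?_
    rw [Finset.prod_congr rfl fun i hi => by rw [(Finset.mem_filter.1 hi).2], Finset.prod_const]
  · rw [hA.trace_aeval, ← Finset.sum_fiberwise_of_maps_to hmem, ← List.sum_toFinset _ hL]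
    refine Finset.sum_congr rfl fun t _ => ?_
    rw [Finset.sum_congr rfl fun i hi => by rw [(Finset.mem_filter.1 hi).2], Finset.sum_const,
      nsmul_eq_mul]

end Spectrum

/-! ### Distance layers -/

namespace SimpleGraph

variable {V : Type u} (G : SimpleGraph V)

/-- The `i`-th distance matrix: the `0`-`1` matrix of the pairs at distance `i`. The extended
distance is used, so that disconnected pairs belong to no layer. -/
noncomputable def layer (i : ℕ) : Matrix V V ℝ :=
  Matrix.of fun u v => if G.edist u v = i then 1 else 0

theorem layer_apply (i : ℕ) (u v : V) : G.layer i u v = if G.edist u v = i then 1 else 0 := rfl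

theorem layer_zero [DecidableEq V] : G.layer 0 = 1 := by
  ext u v
  simp [layer_apply, Matrix.one_apply, edist_eq_zero_iff]

theorem layer_one [DecidableRel G.Adj] : G.layer 1 = G.adjMatrix ℝ := by
  ext u v
  simp [layer_apply, adjMatrix_apply, edist_eq_one_iff_adj]

theorem trace_layer_succ [Fintype V] (i : ℕ) : (G.layer (i + 1)).trace = 0 := by
  refine Finset.sum_eq_zero fun u _ => ?_
  rw [Matrix.diag_apply, layer_apply, if_neg]
  rw [edist_self]
  exact_mod_cast (Nat.succ_ne_zero i).symm

variable {G}

theorem sum_layer {d : ℕ} (hd : ∀ u v, G.edist u v ≤ d) :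
    ∑ i ∈ Finset.range (d + 1), G.layer i = Matrix.of fun _ _ => 1 := by
  ext u v
  obtain ⟨j, hj⟩ := ENat.ne_top_iff_exists.1 (ne_top_of_le_ne_top (ENat.natCast_ne_top _) (hd u v))
  have h1 := hd u v
  rw [← hj] at h1
  have h2 : j ≤ d := by exact_mod_cast h1
  rw [Matrix.sum_apply, Finset.sum_eq_single j]
  · simp [layer_apply, ← hj]
  · intro i _ hi
    rw [layer_apply, if_neg]
    rw [← hj]
    exact_mod_cast hi.symm
  · intro h
    exact absurd (Finset.mem_range.2 (by omega)) h

theorem distMatrix_eq_sum_layer {d : ℕ} (hd : ∀ u v, G.edist u v ≤ d) :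
    distMatrix G = ∑ i ∈ Finset.range (d + 1), (i : ℝ) • G.layer i := by
  ext u v
  obtain ⟨j, hj⟩ := ENat.ne_top_iff_exists.1 (ne_top_of_le_ne_top (ENat.natCast_ne_top _) (hd u v))
  have h1 := hd u v
  rw [← hj] at h1
  have h2 : j ≤ d := by exact_mod_cast h1
  have h3 : G.dist u v = j := by rw [dist, ← hj]; rfl
  rw [Matrix.sum_apply, Finset.sum_eq_single j]
  · simp [layer_apply, ← hj, distMatrix, h3]
  · intro i _ hi
    rw [Matrix.smul_apply, layer_apply, if_neg, smul_zero]
    rw [← hj]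
    exact_mod_cast hi.symm
  · intro h
    exact absurd (Finset.mem_range.2 (by omega)) h

variable [Fintype V] [DecidableRel G.Adj]

theorem adjMatrix_mul_layer_apply (i : ℕ) (u v : V) : (G.adjMatrix ℝ * G.layer i) u v =
    ((G.neighborFinset u).filter fun w => G.edist w v = i).card := by
  rw [adjMatrix_mul_apply]
  simp [layer_apply]

theorem adjMatrix_mul_one_matrix {k : ℕ} (hreg : G.IsRegularOfDegree k) :
    G.adjMatrix ℝ * (Matrix.of fun _ _ => 1) = (k : ℝ) • (Matrix.of fun _ _ => 1) := by
  ext u v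
  rw [adjMatrix_mul_apply]
  simp [hreg u]

/-- The number of neighbours of a vertex at distance `i` that are farther away, as long as `i` is
below half the girth. -/
def forwardDegree (k : ℕ) : ℕ → ℕ
  | 0 => k
  | _ + 1 => k - 1

theorem card_neighborFinset_forwardDegree {k : ℕ} (hreg : G.IsRegularOfDegree k) {i : ℕ}
    (hg : ((2 * i + 1 : ℕ) : ℕ∞) < G.egirth) {u v : V} (hv : G.edist v u = i) :
    ((G.neighborFinset v).filter fun w => G.edist w u = ((i + 1 : ℕ) : ℕ∞)).card =
      forwardDegree k i := by
  cases i with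
  | zero => exact card_neighborFinset_farther_zero hreg (by exact_mod_cast hv)
  | succ i => exact card_neighborFinset_farther hreg hg hv

/-- The three-term recurrence of the distance layers. The parameter `c` is the number of
neighbours of a vertex at distance `i + 2` that are closer: it is `1` below half the girth, and
`k` for the vertices opposite to each other in a Moore graph of even girth. -/
theorem adjMatrix_mul_layer {k c : ℕ} (hreg : G.IsRegularOfDegree k) {i : ℕ}
    (hg : ((2 * (i + 1) + 1 : ℕ) : ℕ∞) < G.egirth)
    (hc : ∀ u v, G.edist u v = ((i + 2 : ℕ) : ℕ∞) →
      ((G.neighborFinset u).filter fun w => G.edist w v = ((i + 1 : ℕ) : ℕ∞)).card = c) :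
    G.adjMatrix ℝ * G.layer (i + 1) =
      (c : ℝ) • G.layer (i + 2) + (forwardDegree k i : ℝ) • G.layer i := by
  ext u v
  rw [adjMatrix_mul_layer_apply, Matrix.add_apply, Matrix.smul_apply, Matrix.smul_apply,
    layer_apply, layer_apply]
  by_cases h2 : G.edist u v = ((i + 2 : ℕ) : ℕ∞)
  · have h0 : ¬ G.edist u v = i := by
      rw [h2]
      exact_mod_cast (by omega : i + 2 ≠ i)
    rw [hc u v h2, if_pos h2, if_neg h0]
    simp
  rw [if_neg h2]
  by_cases h0 : G.edist u v = i
  · rw [if_pos h0, card_neighborFinset_forwardDegree hreg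
      (lt_trans (by exact_mod_cast (by omega : 2 * i + 1 < 2 * (i + 1) + 1)) hg) h0]
    simp
  rw [if_neg h0, Finset.filter_false_of_mem]
  · simp
  intro w hw he
  rw [mem_neighborFinset] at hw
  rcases edist_eq_succ_or_of_adj hg he hw.symm with h | ⟨j, hj, h⟩
  · exact h2 h
  · exact h0 (by rw [h]; congr 1; omega)

theorem adjMatrix_mul_layer_of_lt {k : ℕ} (hreg : G.IsRegularOfDegree k) {i : ℕ}
    (hg : ((2 * (i + 2) : ℕ) : ℕ∞) < G.egirth) :
    G.adjMatrix ℝ * G.layer (i + 1) =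
      G.layer (i + 2) + (forwardDegree k i : ℝ) • G.layer i := by
  have := adjMatrix_mul_layer (c := 1) hreg (i := i)
    (lt_trans (by exact_mod_cast (by omega : 2 * (i + 1) + 1 < 2 * (i + 2))) hg)
    fun u v huv => card_neighborFinset_closer hg huv
  simpa using this

/-- In a Moore graph of even girth, all neighbours of a vertex at the maximal distance are
closer, since every vertex is near one of the endpoints of each edge. -/
theorem adjMatrix_mul_layer_top {k : ℕ} (hreg : G.IsRegularOfDegree k) {i : ℕ}
    (hg : ((2 * (i + 1) + 2 : ℕ) : ℕ∞) ≤ G.egirth)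
    (hc : Fintype.card V = mooreBound k (2 * (i + 1) + 2)) :
    G.adjMatrix ℝ * G.layer (i + 1) =
      (k : ℝ) • G.layer (i + 2) + (forwardDegree k i : ℝ) • G.layer i := by
  refine adjMatrix_mul_layer (c := k) hreg
    (lt_of_lt_of_le (by exact_mod_cast Nat.lt_succ_self _) hg) fun u v huv => ?_
  rw [Finset.filter_true_of_mem]
  · exact hreg u
  intro w hw
  rw [mem_neighborFinset] at hw
  refine le_antisymm ?_ (le_edist_of_adj hw huv)
  rcases edist_le_or_of_card_eq_mooreBound hreg hg hc hw v with h | h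
  · rw [edist_comm, huv] at h
    have : i + 2 ≤ i + 1 := by exact_mod_cast h
    omega
  · rwa [edist_comm]

theorem edist_le_succ_of_card_eq_mooreBound {k d : ℕ} (hk : 1 ≤ k)
    (hreg : G.IsRegularOfDegree k) (hg : ((2 * d + 2 : ℕ) : ℕ∞) ≤ G.egirth)
    (hc : Fintype.card V = mooreBound k (2 * d + 2)) (x u : V) :
    G.edist x u ≤ ((d + 1 : ℕ) : ℕ∞) := by
  obtain ⟨v, huv⟩ := hreg.exists_adj hk u
  rcases edist_le_or_of_card_eq_mooreBound hreg hg hc huv x with h | h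
  · exact h.trans (by exact_mod_cast Nat.le_succ d)
  · have h1 := G.edist_triangle (u := x) (v := v) (w := u)
    rw [edist_eq_one_iff_adj.2 huv.symm] at h1
    push_cast
    exact h1.trans (by gcongr)

end SimpleGraph

/-! ### Distance polynomials of Moore graphs -/

section MooreGraphs

open SimpleGraph

/-- The polynomials `F₀ = 1`, `F₁ = X`, `F₂ = X² - k`, `Fᵢ₊₁ = X Fᵢ - (k - 1) Fᵢ₋₁`, whose values
at the adjacency matrix count non-backtracking walks. -/
noncomputable def layerPoly (k : ℕ) : ℕ → ℝ[X]
  | 0 => 1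
  | 1 => X
  | i + 2 => X * layerPoly k (i + 1) - C (forwardDegree k i : ℝ) * layerPoly k i

variable {V : Type u} [Fintype V] [DecidableEq V] {G : SimpleGraph V} [DecidableRel G.Adj] {k : ℕ}

theorem aeval_layerPoly (hreg : G.IsRegularOfDegree k) (i : ℕ)
    (hg : ((2 * i : ℕ) : ℕ∞) < G.egirth) :
    aeval (G.adjMatrix ℝ) (layerPoly k i) = G.layer i := by
  induction i using Nat.strong_induction_on with
  | _ i ih =>
    match i with
    | 0 => simp [layerPoly, layer_zero]
    | 1 => simp [layerPoly, layer_one]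
    | i + 2 =>
      rw [layerPoly, map_sub, map_mul, map_mul, aeval_X, aeval_C,
        ih (i + 1) (by omega) (lt_trans (by exact_mod_cast (by omega)) hg),
        ih i (by omega) (lt_trans (by exact_mod_cast (by omega)) hg),
        adjMatrix_mul_layer_of_lt hreg hg, Algebra.algebraMap_eq_smul_one, smul_mul_assoc, one_mul,
        add_sub_cancel_right]

/-- The distance polynomials of a Moore graph of even girth and diameter `d`: they agree with
`layerPoly`, except that the last one is divided by `k`, because every vertex at distance `d` is
reached `k` times. -/
noncomputable def evenLayerPoly (k d i : ℕ) : ℝ[X] :=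
  C (if i = d then (k : ℝ)⁻¹ else 1) * layerPoly k i

theorem aeval_evenLayerPoly (hk : 1 ≤ k) (hreg : G.IsRegularOfDegree k) {d : ℕ}
    (hg : ((2 * (d + 1) + 2 : ℕ) : ℕ∞) ≤ G.egirth)
    (hc : Fintype.card V = mooreBound k (2 * (d + 1) + 2)) {i : ℕ} (hi : i ≤ d + 2) :
    aeval (G.adjMatrix ℝ) (evenLayerPoly k (d + 2) i) = G.layer i := by
  have hk0 : (k : ℝ) ≠ 0 := by positivity
  have hlt : ∀ j ≤ d + 1, ((2 * j : ℕ) : ℕ∞) < G.egirth := fun j hj =>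
    lt_of_lt_of_le (by exact_mod_cast (by omega)) hg
  rcases hi.lt_or_eq with h | rfl
  · rw [evenLayerPoly, if_neg h.ne, C_1, one_mul, aeval_layerPoly hreg i (hlt i (by omega))]
  · rw [evenLayerPoly, if_pos rfl, layerPoly, map_mul, map_sub, map_mul, map_mul, aeval_X, aeval_C,
      aeval_C, aeval_layerPoly hreg (d + 1) (hlt _ le_rfl),
      aeval_layerPoly hreg d (hlt _ (by omega)), adjMatrix_mul_layer_top hreg hg hc,
      Algebra.algebraMap_eq_smul_one, Algebra.algebraMap_eq_smul_one, smul_mul_assoc, one_mul,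
      smul_mul_assoc, one_mul, add_sub_cancel_right, smul_smul, inv_mul_cancel₀ hk0, one_smul]

theorem distMatrix_eq_aeval {d : ℕ} (hd : ∀ u v, G.edist u v ≤ d) {F : ℕ → ℝ[X]}
    (hF : ∀ i ≤ d, aeval (G.adjMatrix ℝ) (F i) = G.layer i) {Q : ℝ[X]}
    (hQ : ∀ x, Q.eval x = ∑ i ∈ Finset.range (d + 1), i * (F i).eval x) :
    distMatrix G = aeval (G.adjMatrix ℝ) Q := by
  have hQ' : Q = ∑ i ∈ Finset.range (d + 1), C (i : ℝ) * F i :=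
    Polynomial.funext fun x => by simp [hQ, eval_finsetSum]
  rw [distMatrix_eq_sum_layer hd, hQ', map_sum]
  refine Finset.sum_congr rfl fun i hi => ?_
  rw [map_mul, aeval_C, hF i (by rw [Finset.mem_range] at hi; omega),
    Algebra.algebraMap_eq_smul_one, smul_mul_assoc, one_mul]

/-- Suppose that the distance layers of a `k`-regular graph of diameter at most `d` are the values
of polynomials `F₀, …, F_d` at the adjacency matrix. Then the distance matrix is `∑ i Fᵢ(A)`.
Moreover `∑ Fᵢ(A)` is the all-ones matrix, so that the roots of `(X - k) ∑ Fᵢ` are the only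
possible eigenvalues of `A`, and their multiplicities satisfy a linear system since the layers
other than the identity have trace zero. -/
theorem distMatrix_of_layer_polynomials (hreg : G.IsRegularOfDegree k) {d : ℕ}
    (hd : ∀ u v, G.edist u v ≤ d) {F : ℕ → ℝ[X]}
    (hF : ∀ i ≤ d, aeval (G.adjMatrix ℝ) (F i) = G.layer i) {L : List ℝ} (hL : L.Nodup) {c : ℝ}
    (hLF : ∀ x, (L.map fun t => x - t).prod =
      c * ((x - k) * ∑ i ∈ Finset.range (d + 1), (F i).eval x))
    {Q : ℝ[X]} (hQ : ∀ x, Q.eval x = ∑ i ∈ Finset.range (d + 1), i * (F i).eval x) :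
    distMatrix G = aeval (G.adjMatrix ℝ) Q ∧ ∃ m : ℝ → ℕ,
      (distMatrix G).charpoly = (L.map fun t => (X - C (Q.eval t)) ^ m t).prod ∧
      (L.map fun t => m t * (F 0).eval t).sum = Fintype.card V ∧
      ∀ i, 1 ≤ i → i ≤ d → (L.map fun t => m t * (F i).eval t).sum = 0 := by
  have hA : (G.adjMatrix ℝ).IsHermitian := by
    rw [Matrix.IsHermitian, Matrix.conjTranspose_eq_transpose_of_trivial]
    exact G.isSymm_adjMatrix
  have hD := distMatrix_eq_aeval hd hF hQ
  have hP : (L.map fun t => X - C t).prod =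
      C c * ((X - C (k : ℝ)) * ∑ i ∈ Finset.range (d + 1), F i) :=
    Polynomial.funext fun x => by
      have : eval x ∘ (fun t : ℝ => X - C t) = fun t => x - t := by ext; simp
      simp [eval_list_prod, this, hLF, eval_finsetSum]
  have h0 : aeval (G.adjMatrix ℝ) (L.map fun t => X - C t).prod = 0 := by
    have hsum : ∑ i ∈ Finset.range (d + 1), aeval (G.adjMatrix ℝ) (F i) =
        Matrix.of fun _ _ => 1 := by
      rw [← sum_layer hd]
      exact Finset.sum_congr rfl fun i hi => hF i (by rw [Finset.mem_range] at hi; omega)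
    rw [hP, map_mul, map_mul, map_sub, aeval_X, aeval_C, aeval_C, map_sum, hsum, sub_mul,
      adjMatrix_mul_one_matrix hreg, Algebra.algebraMap_eq_smul_one (k : ℝ), smul_mul_assoc,
      one_mul, sub_self, mul_zero]
  obtain ⟨m, hm⟩ := hA.exists_multiplicity hL h0
  refine ⟨hD, m, ?_, ?_, ?_⟩
  · rw [hD, (hm Q).1]
  · rw [← (hm (F 0)).2, hF 0 (Nat.zero_le d), layer_zero, Matrix.trace_one]
  · intro i hi hid
    obtain ⟨j, rfl⟩ : ∃ j, i = j + 1 := ⟨i - 1, by omega⟩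
    rw [← (hm (F (j + 1))).2, hF _ hid, trace_layer_succ]

/-- The distance matrix and the spectral data of a minimal cage of odd girth `2 * d + 1`. -/
theorem IsMinimalCage.distMatrix_odd {d : ℕ} (h : IsMinimalCage G k (2 * d + 1)) {L : List ℝ}
    (hL : L.Nodup) {c : ℝ}
    (hLF : ∀ x, (L.map fun t => x - t).prod =
      c * ((x - k) * ∑ i ∈ Finset.range (d + 1), (layerPoly k i).eval x))
    {Q : ℝ[X]} (hQ : ∀ x, Q.eval x = ∑ i ∈ Finset.range (d + 1), i * (layerPoly k i).eval x) :
    distMatrix G = aeval (G.adjMatrix ℝ) Q ∧ ∃ m : ℝ → ℕ,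
      (distMatrix G).charpoly = (L.map fun t => (X - C (Q.eval t)) ^ m t).prod ∧
      (L.map fun t => m t * (layerPoly k 0).eval t).sum = mooreBound k (2 * d + 1) ∧
      ∀ i, 1 ≤ i → i ≤ d → (L.map fun t => m t * (layerPoly k i).eval t).sum = 0 := by
  have hreg := h.isCage.isRegularOfGirth.regular
  have hg := h.isCage.isRegularOfGirth.girth_eq
  rw [← h.card_eq]
  exact distMatrix_of_layer_polynomials hreg
    (edist_le_of_card_eq_mooreBound hreg hg.ge h.card_eq)
    (fun i hi => aeval_layerPoly hreg i (by rw [hg]; exact_mod_cast (by omega))) hL hLF hQ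

/-- The distance matrix and the spectral data of a minimal cage of even girth `2 * (d + 2)`. -/
theorem IsMinimalCage.distMatrix_even (hk : 1 ≤ k) {d : ℕ}
    (h : IsMinimalCage G k (2 * (d + 1) + 2)) {L : List ℝ} (hL : L.Nodup)
    (hLF : ∀ x, (L.map fun t => x - t).prod =
      k * ((x - k) * ∑ i ∈ Finset.range (d + 3), (evenLayerPoly k (d + 2) i).eval x))
    {Q : ℝ[X]}
    (hQ : ∀ x, Q.eval x = ∑ i ∈ Finset.range (d + 3), i * (evenLayerPoly k (d + 2) i).eval x) :
    distMatrix G = aeval (G.adjMatrix ℝ) Q ∧ ∃ m : ℝ → ℕ,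
      (distMatrix G).charpoly = (L.map fun t => (X - C (Q.eval t)) ^ m t).prod ∧
      (L.map fun t => m t * (evenLayerPoly k (d + 2) 0).eval t).sum =
        mooreBound k (2 * (d + 1) + 2) ∧
      ∀ i, 1 ≤ i → i ≤ d + 2 →
        (L.map fun t => m t * (evenLayerPoly k (d + 2) i).eval t).sum = 0 := by
  have hreg := h.isCage.isRegularOfGirth.regular
  have hg := h.isCage.isRegularOfGirth.girth_eq
  rw [← h.card_eq]
  exact distMatrix_of_layer_polynomials hreg
    (edist_le_succ_of_card_eq_mooreBound hk hreg hg.ge h.card_eq)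
    (fun i hi => aeval_evenLayerPoly hk hreg hg.ge h.card_eq hi) hL hLF hQ

end MooreGraphs

/-! ### Minimal cages of girth five -/

section Spectra

open SimpleGraph

theorem mooreBound_five {k : ℕ} (hk : 1 ≤ k) : (mooreBound k 5 : ℝ) = (k : ℝ) ^ 2 + 1 := by
  rw [show 5 = 2 * 2 + 1 from rfl, mooreBound_odd]
  simp [Finset.sum_range_succ, Nat.cast_sub hk]
  ring

theorem mooreBound_six {k : ℕ} (hk : 1 ≤ k) : (mooreBound k 6 : ℝ) = 2 * ((k : ℝ) ^ 2 - k + 1) := by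
  rw [show 6 = 2 * 2 + 2 from rfl, mooreBound_even]
  simp [Finset.sum_range_succ, Nat.cast_sub hk]
  ring

theorem mooreBound_eight {k : ℕ} (hk : 1 ≤ k) :
    (mooreBound k 8 : ℝ) = 2 * k * ((k : ℝ) ^ 2 - 2 * k + 2) := by
  rw [show 8 = 2 * 3 + 2 from rfl, mooreBound_even]
  simp [Finset.sum_range_succ, Nat.cast_sub hk]
  ring

theorem mooreBound_twelve {k : ℕ} (hk : 1 ≤ k) :
    (mooreBound k 12 : ℝ) = 2 * k * ((k : ℝ) ^ 2 - k + 1) * ((k : ℝ) ^ 2 - 3 * k + 3) := by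
  rw [show 12 = 2 * 5 + 2 from rfl, mooreBound_even]
  simp [Finset.sum_range_succ, Nat.cast_sub hk]
  ring

theorem eval_layerPoly_zero (k : ℕ) (x : ℝ) : (layerPoly k 0).eval x = 1 := by
  rw [layerPoly, eval_one]

theorem eval_layerPoly_one (k : ℕ) (x : ℝ) : (layerPoly k 1).eval x = x := by
  rw [layerPoly, eval_X]

theorem eval_layerPoly_two (k : ℕ) (x : ℝ) : (layerPoly k 2).eval x = x ^ 2 - k := by
  simp [layerPoly, forwardDegree]
  ring

theorem eval_layerPoly_add_three {k : ℕ} (hk : 1 ≤ k) (i : ℕ) (x : ℝ) :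
    (layerPoly k (i + 3)).eval x =
      x * (layerPoly k (i + 2)).eval x - (k - 1) * (layerPoly k (i + 1)).eval x := by
  simp [layerPoly, forwardDegree, Nat.cast_sub hk]

theorem eval_layerPoly_three {k : ℕ} (hk : 1 ≤ k) (x : ℝ) :
    (layerPoly k 3).eval x = x ^ 3 - (2 * k - 1) * x := by
  rw [eval_layerPoly_add_three hk, eval_layerPoly_two]
  simp [layerPoly]
  ring

theorem eval_layerPoly_four {k : ℕ} (hk : 1 ≤ k) (x : ℝ) :
    (layerPoly k 4).eval x = x ^ 4 - (3 * k - 2) * x ^ 2 + k * (k - 1) := by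
  rw [eval_layerPoly_add_three hk, eval_layerPoly_three hk, eval_layerPoly_two]
  ring

theorem eval_layerPoly_five {k : ℕ} (hk : 1 ≤ k) (x : ℝ) :
    (layerPoly k 5).eval x = x ^ 5 - (4 * k - 3) * x ^ 3 + (k - 1) * (3 * k - 1) * x := by
  rw [eval_layerPoly_add_three hk, eval_layerPoly_four hk, eval_layerPoly_three hk]
  ring

theorem eval_layerPoly_six {k : ℕ} (hk : 1 ≤ k) (x : ℝ) :
    (layerPoly k 6).eval x =
      x ^ 6 - (5 * k - 4) * x ^ 4 + (k - 1) * (6 * k - 3) * x ^ 2 - k * (k - 1) ^ 2 := by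
  rw [eval_layerPoly_add_three hk, eval_layerPoly_five hk, eval_layerPoly_four hk]
  ring

theorem eval_evenLayerPoly (k d i : ℕ) (x : ℝ) : (evenLayerPoly k d i).eval x =
    (if i = d then (k : ℝ)⁻¹ else 1) * (layerPoly k i).eval x := by
  rw [evenLayerPoly, eval_mul, eval_C]

variable {V : Type u} [Fintype V] [DecidableEq V] {G : SimpleGraph V} [DecidableRel G.Adj] {k : ℕ}

theorem IsMinimalCage.distMatrix_five (h : IsMinimalCage G k 5) :
    distMatrix G = -(2 * k : ℝ) • 1 + G.adjMatrix ℝ + (2 : ℝ) • G.adjMatrix ℝ ^ 2 := by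
  have hreg := h.isCage.isRegularOfGirth.regular
  have hg := h.isCage.isRegularOfGirth.girth_eq
  have := distMatrix_eq_aeval (G := G) (d := 2) (F := layerPoly k)
    (Q := -C (2 * k : ℝ) + X + C 2 * X ^ 2)
    (edist_le_of_card_eq_mooreBound hreg hg.ge h.card_eq)
    (fun i hi => aeval_layerPoly hreg i (by rw [hg]; exact_mod_cast (by omega)))
    (fun x => by
      simp [Finset.sum_range_succ, eval_layerPoly_zero, eval_layerPoly_one, eval_layerPoly_two]
      ring)
  rw [this]
  simp only [map_add (aeval (R := ℝ) (G.adjMatrix ℝ)), map_neg (aeval (R := ℝ) (G.adjMatrix ℝ)),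
    map_mul (aeval (R := ℝ) (G.adjMatrix ℝ)), map_pow, aeval_X, aeval_C,
    Algebra.algebraMap_eq_smul_one, smul_mul_assoc, one_mul, neg_smul]

/-- The adjacency eigenvalues of a minimal `(k, 5)`-cage are `k` and the roots `r`, `s` of
`X² + X - (k - 1)`. The multiplicities of `r` and `s` are determined by the order and the trace. -/
theorem IsMinimalCage.spectrum_five (hk : 1 ≤ k) (h : IsMinimalCage G k 5) {r s : ℝ} (hrs : r ≠ s)
    (hr : r ^ 2 + r = k - 1) (hs : s ^ 2 + s = k - 1) {b c : ℕ} (hb : 0 < b) (hc : 0 < c)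
    (h1 : (b : ℝ) + c = (k : ℝ) ^ 2) (h2 : r * b + s * c = -(k : ℝ)) :
    HasDistanceSpectrum G [(2 * (k : ℝ) ^ 2 - k, 1), (-2 - r, b), (-2 - s, c)] := by
  have hk' : (1 : ℝ) ≤ k := by exact_mod_cast hk
  have hsum : r + s = -1 := by
    have : (r - s) * (r + s + 1) = 0 := by linear_combination hr - hs
    rcases mul_eq_zero.1 this with h | h
    · exact absurd (sub_eq_zero.1 h) hrs
    · linarith
  have hne : ∀ t : ℝ, t ^ 2 + t = k - 1 → (k : ℝ) ≠ t := by
    rintro t ht rfl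
    nlinarith
  have hne' : ∀ t : ℝ, t ^ 2 + t = k - 1 → 2 * (k : ℝ) ^ 2 - k ≠ -2 - t := by
    intro t ht h
    have : t = -(2 * (k : ℝ) ^ 2 - k + 2) := by linarith
    subst this
    nlinarith [sq_nonneg (2 * (k : ℝ) ^ 2 - k)]
  obtain ⟨-, m, hm, h0, hi⟩ := IsMinimalCage.distMatrix_odd (d := 2) h (L := [(k : ℝ), r, s])
    (by simp [hrs, hne r hr, hne s hs]) (c := 1)
    (Q := -C (2 * k : ℝ) + X + C 2 * X ^ 2)
    (fun x => by
      simp only [Finset.sum_range_succ, Finset.sum_range_zero, eval_layerPoly_zero,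
        eval_layerPoly_one, eval_layerPoly_two, List.map_cons, List.map_nil, List.prod_cons,
        List.prod_nil]
      rw [show s = -1 - r by linarith]
      linear_combination (-(x - k)) * hr)
    (fun x => by
      simp [Finset.sum_range_succ, eval_layerPoly_zero, eval_layerPoly_one, eval_layerPoly_two]
      ring)
  have e1 := hi 1 le_rfl (by norm_num)
  have e2 := hi 2 (by norm_num) le_rfl
  rw [show 2 * 2 + 1 = 5 from rfl, mooreBound_five hk] at h0
  simp only [List.map_cons, List.map_nil, List.sum_cons, List.sum_nil, eval_layerPoly_two,
    eval_layerPoly_zero, eval_layerPoly_one] at h0 e1 e2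
  have m1 : (m k : ℝ) = 1 := by
    have : ((k : ℝ) ^ 2 + 1) * (m k - 1) = 0 := by
      linear_combination e2 + e1 + h0 - (m r : ℝ) * hr - (m s : ℝ) * hs
    have h3 : (k : ℝ) ^ 2 + 1 ≠ 0 := by positivity
    linarith [(mul_eq_zero.1 this).resolve_left h3]
  have m2 : (m r : ℝ) = b := by
    have : (r - s) * (m r - b) = 0 := by
      linear_combination e1 - h2 - s * h0 + s * h1 + (s - k) * m1
    linarith [(mul_eq_zero.1 this).resolve_left (sub_ne_zero.2 hrs)]
  have m3 : (m s : ℝ) = c := by linarith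
  have m1' : m k = 1 := by exact_mod_cast m1
  have m2' : m r = b := by exact_mod_cast m2
  have m3' : m s = c := by exact_mod_cast m3
  have hQ : ∀ t : ℝ, t ^ 2 + t = k - 1 →
      (-C (2 * k : ℝ) + X + C 2 * X ^ 2).eval t = -2 - t := by
    intro t ht
    simp
    linear_combination 2 * ht
  have hQk : (-C (2 * k : ℝ) + X + C 2 * X ^ 2).eval (k : ℝ) = 2 * (k : ℝ) ^ 2 - k := by
    simp
    ring
  refine ⟨?_, ?_, ?_⟩
  · simp [hrs, hne' r hr, hne' s hs]
  · simp [hb, hc]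
  · rw [hm]
    simp only [List.map_cons, List.map_nil, hQ r hr, hQ s hs, hQk, m1', m2', m3']

end Spectra

/-! ### Linear systems for the multiplicities -/

section Multiplicities

variable {k s r a b z c e f g : ℝ}

/-- The linear system for the multiplicities of `k`, `-k`, `√(k - 1)`, `-√(k - 1)`. -/
theorem multiplicities_six (hk : 3 ≤ k) (hs0 : 0 < s) (hs : s ^ 2 = k - 1)
    (h0 : a + b + c + e = 2 * (k ^ 2 - k + 1))
    (h1 : a * k + b * (-k) + c * s + e * (-s) = 0)
    (h2 : a * (k ^ 2 - k) + b * ((-k) ^ 2 - k) + c * (s ^ 2 - k) + e * ((-s) ^ 2 - k) = 0)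
    (h3 : a * (k ^ 3 - (2 * k - 1) * k) + b * ((-k) ^ 3 - (2 * k - 1) * (-k)) +
      c * (s ^ 3 - (2 * k - 1) * s) + e * ((-s) ^ 3 - (2 * k - 1) * (-s)) = 0) :
    a = 1 ∧ b = 1 ∧ c = k * (k - 1) ∧ e = k * (k - 1) := by
  have hp : k ^ 2 - k + 1 ≠ 0 := by nlinarith
  have hk0 : k ≠ 0 := by positivity
  have hab : a + b = 2 := by
    have : (k ^ 2 - k + 1) * (a + b - 2) = 0 := by
      linear_combination h2 + (k - (k - 1)) * h0 - (c + e) * hs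
    linarith [(mul_eq_zero.1 this).resolve_left hp]
  have hab' : a - b = 0 := by
    have : k * (k ^ 2 - k + 1) * (a - b) = 0 := by
      linear_combination h3 + (2 * k - 1 - (k - 1)) * h1 - (c - e) * s * hs
    exact (mul_eq_zero.1 this).resolve_left (mul_ne_zero hk0 hp)
  have hce : c - e = 0 := by
    have : s * (c - e) = 0 := by linear_combination h1 - k * hab'
    exact (mul_eq_zero.1 this).resolve_left hs0.ne'
  refine ⟨by linarith, by linarith, by linarith, by linarith⟩

/-- The linear system for the multiplicities of `k`, `-k`, `0`, `√(2(k - 1))`, `-√(2(k - 1))`. -/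
theorem multiplicities_eight (hk : 3 ≤ k) (hs0 : 0 < s) (hs : s ^ 2 = 2 * (k - 1))
    (h0 : a + b + z + c + e = 2 * k * (k ^ 2 - 2 * k + 2))
    (h1 : a * k + b * (-k) + c * s + e * (-s) = 0)
    (h2 : a * (k ^ 2 - k) + b * ((-k) ^ 2 - k) + z * (-k) + c * (s ^ 2 - k) +
      e * ((-s) ^ 2 - k) = 0)
    (h3 : a * (k ^ 3 - (2 * k - 1) * k) + b * ((-k) ^ 3 - (2 * k - 1) * (-k)) +
      c * (s ^ 3 - (2 * k - 1) * s) + e * ((-s) ^ 3 - (2 * k - 1) * (-s)) = 0)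
    (h4 : a * (k ^ 4 - (3 * k - 2) * k ^ 2 + k * (k - 1)) +
      b * ((-k) ^ 4 - (3 * k - 2) * (-k) ^ 2 + k * (k - 1)) + z * (k * (k - 1)) +
      c * (s ^ 4 - (3 * k - 2) * s ^ 2 + k * (k - 1)) +
      e * ((-s) ^ 4 - (3 * k - 2) * (-s) ^ 2 + k * (k - 1)) = 0) :
    a = 1 ∧ b = 1 ∧ z = (k - 1) * (k ^ 2 - 2 * k + 2) ∧ c = k ^ 2 * (k - 1) / 2 ∧
      e = k ^ 2 * (k - 1) / 2 := by
  have hp : k ^ 2 - 2 * k + 2 ≠ 0 := by nlinarith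
  have hk0 : k ≠ 0 := by positivity
  have hq0 : k - 1 ≠ 0 := by linarith
  have p2 : k ^ 2 * (a + b) + 2 * (k - 1) * (c + e) = k * (2 * k * (k ^ 2 - 2 * k + 2)) := by
    linear_combination h2 + k * h0 - (c + e) * hs
  have hab : a + b = 2 := by
    have : k ^ 2 * (k ^ 2 - 2 * k + 2) * (a + b - 2) = 0 := by
      linear_combination h4 + (3 * k - 2 - 2 * (k - 1)) * p2 - k * (k - 1) * h0 -
        (c + e) * (s ^ 2 + 2 * (k - 1) - (3 * k - 2)) * hs
    linarith [(mul_eq_zero.1 this).resolve_left (mul_ne_zero (pow_ne_zero 2 hk0) hp)]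
  have hab' : a - b = 0 := by
    have : k * (k ^ 2 - 2 * k + 2) * (a - b) = 0 := by
      linear_combination h3 + (2 * k - 1 - 2 * (k - 1)) * h1 - (c - e) * s * hs
    exact (mul_eq_zero.1 this).resolve_left (mul_ne_zero hk0 hp)
  have hce : c - e = 0 := by
    have : s * (c - e) = 0 := by linear_combination h1 - k * hab'
    exact (mul_eq_zero.1 this).resolve_left hs0.ne'
  have hce' : c + e = k ^ 2 * (k - 1) := by
    apply mul_left_cancel₀ hq0
    linear_combination p2 / 2 - k ^ 2 / 2 * hab
  refine ⟨by linarith, by linarith, by linarith, by linarith, by linarith⟩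

set_option maxHeartbeats 1000000 in
/-- The linear system for the multiplicities of `k`, `-k`, `0`, `√(k - 1)`, `-√(k - 1)`,
`√(3(k - 1))`, `-√(3(k - 1))`. -/
theorem multiplicities_twelve (hk : 3 ≤ k) (hs0 : 0 < s) (hs : s ^ 2 = k - 1) (hr0 : 0 < r)
    (hr : r ^ 2 = 3 * (k - 1))
    (h0 : a + b + z + c + e + f + g = 2 * k * (k ^ 2 - k + 1) * (k ^ 2 - 3 * k + 3))
    (h1 : a * k + b * (-k) + c * s + e * (-s) + f * r + g * (-r) = 0)
    (h2 : a * (k ^ 2 - k) + b * ((-k) ^ 2 - k) + z * (-k) + c * (s ^ 2 - k) +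
      e * ((-s) ^ 2 - k) + f * (r ^ 2 - k) + g * ((-r) ^ 2 - k) = 0)
    (h3 : a * (k ^ 3 - (2 * k - 1) * k) + b * ((-k) ^ 3 - (2 * k - 1) * (-k)) +
      c * (s ^ 3 - (2 * k - 1) * s) + e * ((-s) ^ 3 - (2 * k - 1) * (-s)) +
      f * (r ^ 3 - (2 * k - 1) * r) + g * ((-r) ^ 3 - (2 * k - 1) * (-r)) = 0)
    (h4 : a * (k ^ 4 - (3 * k - 2) * k ^ 2 + k * (k - 1)) +
      b * ((-k) ^ 4 - (3 * k - 2) * (-k) ^ 2 + k * (k - 1)) + z * (k * (k - 1)) +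
      c * (s ^ 4 - (3 * k - 2) * s ^ 2 + k * (k - 1)) +
      e * ((-s) ^ 4 - (3 * k - 2) * (-s) ^ 2 + k * (k - 1)) +
      f * (r ^ 4 - (3 * k - 2) * r ^ 2 + k * (k - 1)) +
      g * ((-r) ^ 4 - (3 * k - 2) * (-r) ^ 2 + k * (k - 1)) = 0)
    (h5 : a * (k ^ 5 - (4 * k - 3) * k ^ 3 + (k - 1) * (3 * k - 1) * k) +
      b * ((-k) ^ 5 - (4 * k - 3) * (-k) ^ 3 + (k - 1) * (3 * k - 1) * (-k)) +
      c * (s ^ 5 - (4 * k - 3) * s ^ 3 + (k - 1) * (3 * k - 1) * s) +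
      e * ((-s) ^ 5 - (4 * k - 3) * (-s) ^ 3 + (k - 1) * (3 * k - 1) * (-s)) +
      f * (r ^ 5 - (4 * k - 3) * r ^ 3 + (k - 1) * (3 * k - 1) * r) +
      g * ((-r) ^ 5 - (4 * k - 3) * (-r) ^ 3 + (k - 1) * (3 * k - 1) * (-r)) = 0)
    (h6 : a * (k ^ 6 - (5 * k - 4) * k ^ 4 + (k - 1) * (6 * k - 3) * k ^ 2 - k * (k - 1) ^ 2) +
      b * ((-k) ^ 6 - (5 * k - 4) * (-k) ^ 4 + (k - 1) * (6 * k - 3) * (-k) ^ 2 -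
        k * (k - 1) ^ 2) + z * (-(k * (k - 1) ^ 2)) +
      c * (s ^ 6 - (5 * k - 4) * s ^ 4 + (k - 1) * (6 * k - 3) * s ^ 2 - k * (k - 1) ^ 2) +
      e * ((-s) ^ 6 - (5 * k - 4) * (-s) ^ 4 + (k - 1) * (6 * k - 3) * (-s) ^ 2 -
        k * (k - 1) ^ 2) +
      f * (r ^ 6 - (5 * k - 4) * r ^ 4 + (k - 1) * (6 * k - 3) * r ^ 2 - k * (k - 1) ^ 2) +
      g * ((-r) ^ 6 - (5 * k - 4) * (-r) ^ 4 + (k - 1) * (6 * k - 3) * (-r) ^ 2 -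
        k * (k - 1) ^ 2) = 0) :
    a = 1 ∧ b = 1 ∧ z = 2 * (k - 1) * (k ^ 2 - k + 1) * (k ^ 2 - 3 * k + 3) / 3 ∧
      c = k ^ 2 * (k - 1) * (k ^ 2 - 3 * k + 3) / 2 ∧
      e = k ^ 2 * (k - 1) * (k ^ 2 - 3 * k + 3) / 2 ∧
      f = k ^ 2 * (k - 1) * (k ^ 2 - k + 1) / 6 ∧ g = k ^ 2 * (k - 1) * (k ^ 2 - k + 1) / 6 := by
  have hp : k ^ 2 - k + 1 ≠ 0 := by nlinarith
  have hp' : k ^ 2 - 3 * k + 3 ≠ 0 := by nlinarith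
  have hk0 : k ≠ 0 := by positivity
  have hq0 : k - 1 ≠ 0 := by linarith
  have hs4 : s ^ 4 = (k - 1) ^ 2 := by rw [← hs]; ring
  have hs6 : s ^ 6 = (k - 1) ^ 3 := by rw [← hs]; ring
  have hr4 : r ^ 4 = 9 * (k - 1) ^ 2 := by linear_combination (r ^ 2 + 3 * (k - 1)) * hr
  have hr6 : r ^ 6 = 27 * (k - 1) ^ 3 := by
    linear_combination (r ^ 4 + 3 * (k - 1) * r ^ 2 + 9 * (k - 1) ^ 2) * hr
  set n := 2 * k * (k ^ 2 - k + 1) * (k ^ 2 - 3 * k + 3) with hn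
  -- The even power sums determine `a + b`, `c + e`, `f + g`.
  have p2 : k ^ 2 * (a + b) + (k - 1) * (c + e) + 3 * (k - 1) * (f + g) = k * n := by
    linear_combination h2 + k * h0 - (c + e) * hs - (f + g) * hr
  have p4 : k ^ 4 * (a + b) + (k - 1) ^ 2 * (c + e) + 9 * (k - 1) ^ 2 * (f + g) =
      k * (2 * k - 1) * n := by
    linear_combination h4 + (3 * k - 2) * (h2 + k * h0) - k * (k - 1) * h0 - (c + e) * hs4 -
      (f + g) * hr4
  have p6 : k ^ 6 * (a + b) + (k - 1) ^ 3 * (c + e) + 27 * (k - 1) ^ 3 * (f + g) =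
      ((5 * k - 4) * (2 * k - 1) - (k - 1) * (6 * k - 3) + (k - 1) ^ 2) * k * n := by
    linear_combination h6 + (5 * k - 4) * (h4 + (3 * k - 2) * (h2 + k * h0) - k * (k - 1) * h0) -
      (k - 1) * (6 * k - 3) * (h2 + k * h0) + k * (k - 1) ^ 2 * h0 - (c + e) * hs6 - (f + g) * hr6
  have hab : a + b = 2 := by
    have : k ^ 2 * ((k ^ 2 - k + 1) * (k ^ 2 - 3 * k + 3)) * (a + b - 2) = 0 := by
      rw [hn] at p2 p4 p6
      linear_combination p6 - 4 * (k - 1) * p4 + 3 * (k - 1) ^ 2 * p2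
    linarith [(mul_eq_zero.1 this).resolve_left
      (mul_ne_zero (pow_ne_zero 2 hk0) (mul_ne_zero hp hp'))]
  have hfg : f + g = k ^ 2 * (k - 1) * (k ^ 2 - k + 1) / 3 := by
    apply mul_left_cancel₀ (pow_ne_zero 2 hq0)
    rw [hn] at p2 p4
    linear_combination (p4 - (k - 1) * p2 - k ^ 2 * (k ^ 2 - k + 1) * hab) / 6
  have hce : c + e = k ^ 2 * (k - 1) * (k ^ 2 - 3 * k + 3) := by
    apply mul_left_cancel₀ hq0
    rw [hn] at p2
    linear_combination p2 - k ^ 2 * hab - 3 * (k - 1) * hfg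
  -- The odd power sums show that opposite eigenvalues have equal multiplicities.
  have q3 : k ^ 3 * (a - b) + (k - 1) * s * (c - e) + 3 * (k - 1) * r * (f - g) = 0 := by
    linear_combination h3 + (2 * k - 1) * h1 - (c - e) * s * hs - (f - g) * r * hr
  have q5 : k ^ 5 * (a - b) + (k - 1) ^ 2 * s * (c - e) + 9 * (k - 1) ^ 2 * r * (f - g) = 0 := by
    linear_combination h5 + (4 * k - 3) * (h3 + (2 * k - 1) * h1) - (k - 1) * (3 * k - 1) * h1 -
      (c - e) * s * hs4 - (f - g) * r * hr4
  have hab' : a - b = 0 := by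
    have : k * ((k ^ 2 - k + 1) * (k ^ 2 - 3 * k + 3)) * (a - b) = 0 := by
      linear_combination q5 - 4 * (k - 1) * q3 + 3 * (k - 1) ^ 2 * h1
    exact (mul_eq_zero.1 this).resolve_left (mul_ne_zero hk0 (mul_ne_zero hp hp'))
  have hfg' : f - g = 0 := by
    have : (k - 1) * r * (f - g) = 0 := by
      linear_combination (q3 - (k - 1) * h1 - k * (k ^ 2 - k + 1) * hab') / 2
    exact (mul_eq_zero.1 this).resolve_left (mul_ne_zero hq0 hr0.ne')
  have hce' : c - e = 0 := by
    have : s * (c - e) = 0 := by linear_combination h1 - k * hab' - r * hfg'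
    exact (mul_eq_zero.1 this).resolve_left hs0.ne'
  refine ⟨by linarith, by linarith, ?_, by linarith, by linarith, by linarith, by linarith⟩
  rw [hn] at h0
  linear_combination h0 - hab - hce - hfg

end Multiplicities

/-! ### Distinctness of the distance eigenvalues -/

section Distinctness

variable {k s r : ℝ}

/-- The second and the third eigenvalue are distinct only because `k` is an integer: a coincidence
means `(q² - q - 1)² = 4 q` with `q = k - 1`, which has a real solution between `2` and `3`. -/
theorem nodup_six (hk : k = 3 ∨ 4 ≤ k) (hs0 : 0 < s) (hs : s ^ 2 = k - 1) :
    [5 * k ^ 2 - 7 * k + 3, -k ^ 2 + 3 * k - 3, -2 * (1 + s), -2 * (1 - s)].Nodup := by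
  have hk3 : 3 ≤ k := by rcases hk with h | h <;> linarith
  have hsk : s < k := by nlinarith
  have hs1 : 1 < s := by nlinarith
  have h2 : -k ^ 2 + 3 * k - 3 < 0 := by nlinarith
  have h12 : 2 * k < 5 * k ^ 2 - 7 * k + 3 := by nlinarith
  have h23 : -k ^ 2 + 3 * k - 3 ≠ -2 * (1 + s) := by
    intro h
    have h1 : k ^ 2 - 3 * k + 1 = 2 * s := by linarith
    rcases hk with rfl | h4
    · have : s = 1 / 2 := by linarith
      subst this
      norm_num at hs
    · have h5 : s ≤ k / 2 := abs_le_of_sq_le_sq' (by nlinarith [sq_nonneg (k - 2)]) (by linarith) |>.2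
      nlinarith
  simp only [List.nodup_cons, List.mem_cons, List.not_mem_nil, or_false, not_or, List.nodup_nil,
    not_false_eq_true, and_true]
  refine ⟨⟨?_, ?_, ?_⟩, ⟨h23, ?_⟩, ?_⟩ <;> intro h <;> linarith

theorem nodup_eight (hk : 3 ≤ k) (hs0 : 0 < s) (hs : s ^ 2 = 2 * (k - 1)) :
    [7 * k ^ 3 - 16 * k ^ 2 + 14 * k - 4, k ^ 3 - 4 * k ^ 2 + 6 * k - 4, 2 * k - 4, -2 * (k + s),
      -2 * (k - s)].Nodup := by
  have hsk : s < k := by nlinarith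
  have h12 : 0 < k * (6 * k ^ 2 - 12 * k + 8) := mul_pos (by linarith) (by nlinarith)
  have h23 : 0 < k * (k - 2) ^ 2 := mul_pos (by linarith) (pow_pos (by linarith) 2)
  ring_nf at h12 h23
  simp only [List.nodup_cons, List.mem_cons, List.not_mem_nil, or_false, not_or, List.nodup_nil,
    not_false_eq_true, and_true]
  refine ⟨⟨?_, ?_, ?_, ?_⟩, ⟨?_, ?_, ?_⟩, ⟨?_, ?_⟩, ?_⟩ <;> intro h <;> linarith

theorem nodup_twelve (hk : 3 ≤ k) (hs0 : 0 < s) (hs : s ^ 2 = k - 1) (hr0 : 0 < r)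
    (hr : r ^ 2 = 3 * (k - 1)) :
    [11 * k ^ 5 - 46 * k ^ 4 + 81 * k ^ 3 - 72 * k ^ 2 + 33 * k - 6,
      k ^ 5 - 6 * k ^ 4 + 15 * k ^ 3 - 20 * k ^ 2 + 15 * k - 6, -2 * k ^ 2 + 6 * k - 6,
      2 * (k - 2) * (k + s), 2 * (k - 2) * (k - s), -2 * k * (k + r), -2 * k * (k - r)].Nodup := by
  have hsk : s < k := by nlinarith
  have hrk : r < k := by nlinarith
  have h12 : k ^ 5 - 6 * k ^ 4 + 15 * k ^ 3 - 20 * k ^ 2 + 15 * k - 6 <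
      11 * k ^ 5 - 46 * k ^ 4 + 81 * k ^ 3 - 72 * k ^ 2 + 33 * k - 6 := by
    obtain ⟨t, rfl⟩ : ∃ t, k = t + 3 := ⟨k - 3, by ring⟩
    have ht : 0 ≤ t := by linarith
    have : 0 < (t + 3) * (10 * t ^ 4 + 80 * t ^ 3 + 246 * t ^ 2 + 344 * t + 186) := by positivity
    linarith
  have h24 : 2 * (k - 2) * (k + s) < k ^ 5 - 6 * k ^ 4 + 15 * k ^ 3 - 20 * k ^ 2 + 15 * k - 6 := by
    have h1 : 7 * 3 ≤ (k ^ 2 - k + 1) * (k ^ 2 - 3 * k + 3) :=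
      mul_le_mul (by nlinarith) (by nlinarith) (by norm_num) (by nlinarith)
    have h2 : 2 * (k + s) < (k ^ 2 - k + 1) * (k ^ 2 - 3 * k + 3) := by
      have h3 : (2 * k + 1) * 3 ≤ (k ^ 2 - k + 1) * (k ^ 2 - 3 * k + 3) :=
        mul_le_mul (by nlinarith) (by nlinarith) (by norm_num) (by nlinarith)
      linarith
    have h4 := mul_lt_mul_of_pos_left h2 (by linarith : 0 < k - 2)
    linarith
  have h45 : 2 * (k - 2) * (k - s) < 2 * (k - 2) * (k + s) :=
    mul_lt_mul_of_pos_left (by linarith) (by linarith)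
  have h5 : 0 < 2 * (k - 2) * (k - s) := mul_pos (by linarith) (by linarith)
  have h67 : -2 * k * (k + r) < -2 * k ^ 2 + 6 * k - 6 := by
    nlinarith [mul_pos hr0 (by linarith : 0 < k + r)]
  have h37 : -2 * k ^ 2 + 6 * k - 6 < -2 * k * (k - r) := by
    nlinarith [mul_pos hr0 (by linarith : 0 < k - r)]
  have h7 : -2 * k * (k - r) < 0 := by nlinarith
  simp only [List.nodup_cons, List.mem_cons, List.not_mem_nil, or_false, not_or, List.nodup_nil,
    not_false_eq_true, and_true]
  refine ⟨⟨?_, ?_, ?_, ?_, ?_, ?_⟩, ⟨?_, ?_, ?_, ?_, ?_⟩, ⟨?_, ?_, ?_, ?_⟩, ⟨?_, ?_, ?_⟩,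
    ⟨?_, ?_⟩, ?_⟩ <;> intro h <;> linarith

end Distinctness

/-! ### Distance spectra of minimal cages of even girth -/

section EvenSpectra

open SimpleGraph

variable {V : Type u} [Fintype V] [DecidableEq V] {G : SimpleGraph V} [DecidableRel G.Adj] {k : ℕ}

/-- The adjacency eigenvalues of a minimal `(k, 6)`-cage are `±k` and `±√(k - 1)`. -/
theorem IsMinimalCage.spectrum_six (hk : 3 ≤ k) (h : IsMinimalCage G k 6) :
    distMatrix G =
      (3 / k : ℝ) • G.adjMatrix ℝ ^ 3 + (2 : ℝ) • G.adjMatrix ℝ ^ 2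
        - ((5 * k - 3) / k : ℝ) • G.adjMatrix ℝ - (2 * k : ℝ) • 1 ∧
    ∃ m : ℕ,
      (m : ℝ) = Fintype.card V * k * (k - 1) / (2 * ((k : ℝ) ^ 2 - k + 1)) ∧
      HasDistanceSpectrum G
        [(5 * (k : ℝ) ^ 2 - 7 * k + 3, 1),
         (-(k : ℝ) ^ 2 + 3 * k - 3, 1),
         (-2 * (1 + Real.sqrt (k - 1)), m),
         (-2 * (1 - Real.sqrt (k - 1)), m)] := by
  have hk1 : 1 ≤ k := by omega
  have hk3 : (3 : ℝ) ≤ k := by exact_mod_cast hk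
  have hcard : (Fintype.card V : ℝ) = 2 * ((k : ℝ) ^ 2 - k + 1) := by
    rw [h.card_eq, mooreBound_six hk1]
  set s := Real.sqrt ((k : ℝ) - 1)
  have hs : s ^ 2 = k - 1 := Real.sq_sqrt (by linarith)
  have hs0 : 0 < s := Real.sqrt_pos.2 (by linarith)
  have hsk : s < k := by nlinarith
  have hk0 : (k : ℝ) ≠ 0 := by positivity
  have hnd : [(k : ℝ), -k, s, -s].Nodup := by
    simp only [List.nodup_cons, List.mem_cons, List.not_mem_nil, or_false, not_or, List.nodup_nil,
      not_false_eq_true, and_true]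
    refine ⟨⟨?_, ?_, ?_⟩, ⟨?_, ?_⟩, ?_⟩ <;> intro h <;> linarith
  obtain ⟨hD, m, hm, h0, hi⟩ := IsMinimalCage.distMatrix_even hk1 (d := 1) h hnd
    (Q := C (3 / k : ℝ) * X ^ 3 + C 2 * X ^ 2 - C ((5 * k - 3) / k : ℝ) * X - C (2 * k : ℝ))
    (fun x => by
      simp [Finset.sum_range_succ, eval_evenLayerPoly, eval_layerPoly_zero, eval_layerPoly_one,
        eval_layerPoly_two, eval_layerPoly_three hk1, -mul_eq_mul_left_iff]
      field_simp
      linear_combination (k ^ 2 - x ^ 2) * hs)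
    (fun x => by
      simp [Finset.sum_range_succ, eval_evenLayerPoly, eval_layerPoly_zero, eval_layerPoly_one,
        eval_layerPoly_two, eval_layerPoly_three hk1]
      field_simp
      ring)
  have e1 := hi 1 le_rfl (by norm_num)
  have e2 := hi 2 (by norm_num) (by norm_num)
  have e3 := hi 3 (by norm_num) le_rfl
  replace h0 := h0.trans (mooreBound_six hk1)
  simp only [List.map_cons, List.map_nil, List.sum_cons, List.sum_nil, eval_evenLayerPoly,
    eval_layerPoly_zero, eval_layerPoly_one, eval_layerPoly_two, eval_layerPoly_three hk1,
    Nat.reduceAdd, Nat.reduceEqDiff, if_true, if_false, one_mul, mul_one] at h0 e1 e2 e3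
  replace e3 := congrArg ((k : ℝ) * ·) e3
  obtain ⟨ma, mb, mc, me⟩ := multiplicities_six hk3 hs0 hs (a := m k) (b := m (-k)) (c := m s)
    (e := m (-s)) (by linear_combination h0) (by linear_combination e1)
    (by linear_combination e2) (by field_simp at e3; linear_combination e3)
  have ma' : m k = 1 := by exact_mod_cast ma
  have mb' : m (-k) = 1 := by exact_mod_cast mb
  have me' : m (-s) = m s := by exact_mod_cast me.trans mc.symm
  have hspos : 0 < m s := by
    have : (0 : ℝ) < m s := by
      rw [mc]
      exact mul_pos (by linarith) (by linarith)
    exact_mod_cast this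
  refine ⟨?_, m s, ?_, ?_, ?_, ?_⟩
  · rw [hD]
    simp only [map_add (aeval (R := ℝ) (G.adjMatrix ℝ)), map_sub (aeval (R := ℝ) (G.adjMatrix ℝ)),
      map_mul (aeval (R := ℝ) (G.adjMatrix ℝ)), map_pow, aeval_X, aeval_C,
      Algebra.algebraMap_eq_smul_one, smul_mul_assoc, one_mul]
  · have : (k : ℝ) ^ 2 - k + 1 ≠ 0 := by nlinarith
    rw [mc, hcard, eq_div_iff (mul_ne_zero two_ne_zero this)]
    ring
  · refine nodup_six ?_ hs0 hs
    rcases hk.eq_or_lt with h3 | h3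
    · exact Or.inl (by exact_mod_cast h3.symm)
    · exact Or.inr (by exact_mod_cast h3)
  · simp [hspos]
  · obtain ⟨q, hq⟩ : ∃ q : ℝ → ℝ, ∀ x, q x =
        (3 * x ^ 3 + 2 * k * x ^ 2 - (5 * k - 3) * x - 2 * k ^ 2) / k := ⟨_, fun _ => rfl⟩
    have hQ : ∀ x : ℝ, (C (3 / k : ℝ) * X ^ 3 + C 2 * X ^ 2 - C ((5 * k - 3) / k : ℝ) * X
        - C (2 * k : ℝ)).eval x = q x := by
      intro x
      rw [hq]
      simp
      field_simp
    have hqs : ∀ x : ℝ, x ^ 2 = k - 1 → q x = -2 * (1 + x) := by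
      intro x hx
      rw [hq, div_eq_iff hk0]
      linear_combination (3 * x + 2 * k) * hx
    have hq1 : q k = 5 * (k : ℝ) ^ 2 - 7 * k + 3 := by
      rw [hq, div_eq_iff hk0]
      ring
    have hq2 : q (-k) = -(k : ℝ) ^ 2 + 3 * k - 3 := by
      rw [hq, div_eq_iff hk0]
      ring
    rw [hm]
    simp only [List.map_cons, List.map_nil, hQ]
    rw [hq1, hq2, hqs s hs, hqs (-s) (by rw [neg_sq, hs]), ma', mb', me', ← sub_eq_add_neg]

/-- The adjacency eigenvalues of a minimal `(k, 8)`-cage are `±k`, `0` and `±√(2(k - 1))`. -/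
theorem IsMinimalCage.spectrum_eight (hk : 3 ≤ k) (h : IsMinimalCage G k 8) :
    distMatrix G =
      (4 / k : ℝ) • G.adjMatrix ℝ ^ 4 + (3 : ℝ) • G.adjMatrix ℝ ^ 3
        + ((8 - 10 * k) / k : ℝ) • G.adjMatrix ℝ ^ 2 - (6 * k - 4 : ℝ) • G.adjMatrix ℝ
        + (2 * k - 4 : ℝ) • 1 ∧
    ∃ m₀ m₁ : ℕ,
      (m₀ : ℝ) = Fintype.card V * (k - 1) / (2 * (k : ℝ)) ∧
      (m₁ : ℝ) = Fintype.card V * k * (k - 1) / (4 * ((k : ℝ) ^ 2 - 2 * k + 2)) ∧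
      HasDistanceSpectrum G
        [(7 * (k : ℝ) ^ 3 - 16 * (k : ℝ) ^ 2 + 14 * k - 4, 1),
         ((k : ℝ) ^ 3 - 4 * (k : ℝ) ^ 2 + 6 * k - 4, 1),
         (2 * (k : ℝ) - 4, m₀),
         (-2 * (k + Real.sqrt (2 * (k - 1))), m₁),
         (-2 * (k - Real.sqrt (2 * (k - 1))), m₁)] := by
  have hk1 : 1 ≤ k := by omega
  have hk3 : (3 : ℝ) ≤ k := by exact_mod_cast hk
  have hcard : (Fintype.card V : ℝ) = 2 * k * ((k : ℝ) ^ 2 - 2 * k + 2) := by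
    rw [h.card_eq, mooreBound_eight hk1]
  set s := Real.sqrt (2 * ((k : ℝ) - 1))
  have hs : s ^ 2 = 2 * (k - 1) := Real.sq_sqrt (by linarith)
  have hs0 : 0 < s := Real.sqrt_pos.2 (by linarith)
  have hsk : s < k := by nlinarith
  have hk0 : (k : ℝ) ≠ 0 := by positivity
  have hp : 0 < (k : ℝ) ^ 2 - 2 * k + 2 := by nlinarith
  have hnd : [(k : ℝ), -k, 0, s, -s].Nodup := by
    simp only [List.nodup_cons, List.mem_cons, List.not_mem_nil, or_false, not_or, List.nodup_nil,
      not_false_eq_true, and_true]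
    refine ⟨⟨?_, ?_, ?_, ?_⟩, ⟨?_, ?_, ?_⟩, ⟨?_, ?_⟩, ?_⟩ <;> intro h <;> linarith
  obtain ⟨hD, m, hm, h0, hi⟩ := IsMinimalCage.distMatrix_even hk1 (d := 2) h hnd
    (Q := C (4 / k : ℝ) * X ^ 4 + C 3 * X ^ 3 + C ((8 - 10 * k) / k : ℝ) * X ^ 2
      - C (6 * k - 4 : ℝ) * X + C (2 * k - 4 : ℝ))
    (fun x => by
      simp [Finset.sum_range_succ, eval_evenLayerPoly, eval_layerPoly_zero, eval_layerPoly_one,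
        eval_layerPoly_two, eval_layerPoly_three hk1, eval_layerPoly_four hk1,
        -mul_eq_mul_left_iff]
      field_simp
      linear_combination (k ^ 2 - x ^ 2) * x * hs)
    (fun x => by
      simp [Finset.sum_range_succ, eval_evenLayerPoly, eval_layerPoly_zero, eval_layerPoly_one,
        eval_layerPoly_two, eval_layerPoly_three hk1, eval_layerPoly_four hk1]
      field_simp
      ring)
  have e1 := hi 1 le_rfl (by norm_num)
  have e2 := hi 2 (by norm_num) (by norm_num)
  have e3 := hi 3 (by norm_num) (by norm_num)
  have e4 := hi 4 (by norm_num) le_rfl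
  replace h0 := h0.trans (mooreBound_eight hk1)
  simp only [List.map_cons, List.map_nil, List.sum_cons, List.sum_nil, eval_evenLayerPoly,
    eval_layerPoly_zero, eval_layerPoly_one, eval_layerPoly_two, eval_layerPoly_three hk1,
    eval_layerPoly_four hk1, Nat.reduceAdd, Nat.reduceEqDiff, if_true, if_false, one_mul,
    mul_one] at h0 e1 e2 e3 e4
  replace e4 := congrArg ((k : ℝ) * ·) e4
  obtain ⟨ma, mb, mz, mc, me⟩ := multiplicities_eight hk3 hs0 hs (a := m k) (b := m (-k))
    (z := m 0) (c := m s) (e := m (-s)) (by linear_combination h0) (by linear_combination e1)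
    (by linear_combination e2) (by linear_combination e3)
    (by field_simp at e4; linear_combination e4)
  have ma' : m k = 1 := by exact_mod_cast ma
  have mb' : m (-k) = 1 := by exact_mod_cast mb
  have me' : m (-s) = m s := by exact_mod_cast me.trans mc.symm
  have hzpos : 0 < m 0 := by
    have : (0 : ℝ) < m 0 := by
      rw [mz]
      exact mul_pos (by linarith) hp
    exact_mod_cast this
  have hspos : 0 < m s := by
    have : (0 : ℝ) < m s := by
      rw [mc]
      have : (0 : ℝ) < k - 1 := by linarith
      positivity
    exact_mod_cast this
  refine ⟨?_, m 0, m s, ?_, ?_, ?_, ?_, ?_⟩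
  · rw [hD]
    simp only [map_add (aeval (R := ℝ) (G.adjMatrix ℝ)), map_sub (aeval (R := ℝ) (G.adjMatrix ℝ)),
      map_mul (aeval (R := ℝ) (G.adjMatrix ℝ)), map_pow, aeval_X, aeval_C,
      Algebra.algebraMap_eq_smul_one, smul_mul_assoc, one_mul]
  · rw [mz, hcard]
    field_simp
  · rw [mc, hcard, eq_div_iff (mul_ne_zero four_ne_zero hp.ne')]
    ring
  · exact nodup_eight hk3 hs0 hs
  · simp [hspos, hzpos]
  · obtain ⟨q, hq⟩ : ∃ q : ℝ → ℝ, ∀ x, q x =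
        (4 * x ^ 4 + 3 * k * x ^ 3 + (8 - 10 * k) * x ^ 2 - (6 * k - 4) * k * x
          + (2 * k - 4) * k) / k := ⟨_, fun _ => rfl⟩
    have hQ : ∀ x : ℝ, (C (4 / k : ℝ) * X ^ 4 + C 3 * X ^ 3 + C ((8 - 10 * k) / k : ℝ) * X ^ 2
        - C (6 * k - 4 : ℝ) * X + C (2 * k - 4 : ℝ)).eval x = q x := by
      intro x
      rw [hq]
      simp
      field_simp
    have hqs : ∀ x : ℝ, x ^ 2 = 2 * (k - 1) → q x = -2 * (k + x) := by
      intro x hx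
      rw [hq, div_eq_iff hk0]
      linear_combination (4 * x ^ 2 + 3 * k * x - 2 * k) * hx
    have hq1 : q k = 7 * (k : ℝ) ^ 3 - 16 * (k : ℝ) ^ 2 + 14 * k - 4 := by
      rw [hq, div_eq_iff hk0]
      ring
    have hq2 : q (-k) = (k : ℝ) ^ 3 - 4 * (k : ℝ) ^ 2 + 6 * k - 4 := by
      rw [hq, div_eq_iff hk0]
      ring
    have hq0 : q 0 = 2 * (k : ℝ) - 4 := by
      rw [hq, div_eq_iff hk0]
      ring
    rw [hm]
    simp only [List.map_cons, List.map_nil, hQ]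
    rw [hq1, hq2, hq0, hqs s hs, hqs (-s) (by rw [neg_sq, hs]), ma', mb', me', ← sub_eq_add_neg]

/-- The adjacency eigenvalues of a minimal `(k, 12)`-cage are `±k`, `0`, `±√(k - 1)` and
`±√(3(k - 1))`. -/
theorem IsMinimalCage.spectrum_twelve (hk : 3 ≤ k) (h : IsMinimalCage G k 12) :
    distMatrix G =
      (6 / k : ℝ) • G.adjMatrix ℝ ^ 6 + (5 : ℝ) • G.adjMatrix ℝ ^ 5
        + ((24 - 26 * k) / k : ℝ) • G.adjMatrix ℝ ^ 4
        - (20 * k - 18 : ℝ) • G.adjMatrix ℝ ^ 3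
        + ((24 * (k : ℝ) ^ 2 - 44 * k + 18) / k) • G.adjMatrix ℝ ^ 2
        + (15 * (k : ℝ) ^ 2 - 26 * k + 9) • G.adjMatrix ℝ
        - (2 * (k : ℝ) ^ 2 - 6 * k + 6) • 1 ∧
    ∃ m₀ m₁ m₂ : ℕ,
      (m₀ : ℝ) = Fintype.card V * (k - 1) / (3 * (k : ℝ)) ∧
      (m₁ : ℝ) = Fintype.card V * k * (k - 1) / (4 * ((k : ℝ) ^ 2 - k + 1)) ∧
      (m₂ : ℝ) = Fintype.card V * k * (k - 1) / (12 * ((k : ℝ) ^ 2 - 3 * k + 3)) ∧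
      HasDistanceSpectrum G
        [(11 * (k : ℝ) ^ 5 - 46 * (k : ℝ) ^ 4 + 81 * (k : ℝ) ^ 3 - 72 * (k : ℝ) ^ 2
            + 33 * k - 6, 1),
         ((k : ℝ) ^ 5 - 6 * (k : ℝ) ^ 4 + 15 * (k : ℝ) ^ 3 - 20 * (k : ℝ) ^ 2
            + 15 * k - 6, 1),
         (-2 * (k : ℝ) ^ 2 + 6 * k - 6, m₀),
         (2 * (k - 2) * (k + Real.sqrt (k - 1)), m₁),
         (2 * (k - 2) * (k - Real.sqrt (k - 1)), m₁),
         (-2 * k * (k + Real.sqrt (3 * (k - 1))), m₂),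
         (-2 * k * (k - Real.sqrt (3 * (k - 1))), m₂)] := by
  have hk1 : 1 ≤ k := by omega
  have hk3 : (3 : ℝ) ≤ k := by exact_mod_cast hk
  have hcard : (Fintype.card V : ℝ) =
      2 * k * ((k : ℝ) ^ 2 - k + 1) * ((k : ℝ) ^ 2 - 3 * k + 3) := by
    rw [h.card_eq, mooreBound_twelve hk1]
  set s := Real.sqrt ((k : ℝ) - 1)
  set r := Real.sqrt (3 * ((k : ℝ) - 1))
  have hs : s ^ 2 = k - 1 := Real.sq_sqrt (by linarith)
  have hs0 : 0 < s := Real.sqrt_pos.2 (by linarith)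
  have hr : r ^ 2 = 3 * (k - 1) := Real.sq_sqrt (by linarith)
  have hr0 : 0 < r := Real.sqrt_pos.2 (by linarith)
  have hsr : s < r := by nlinarith
  have hrk : r < k := by nlinarith
  have hk0 : (k : ℝ) ≠ 0 := by positivity
  have hp : 0 < (k : ℝ) ^ 2 - k + 1 := by nlinarith
  have hp' : 0 < (k : ℝ) ^ 2 - 3 * k + 3 := by nlinarith
  have hnd : [(k : ℝ), -k, 0, s, -s, r, -r].Nodup := by
    simp only [List.nodup_cons, List.mem_cons, List.not_mem_nil, or_false, not_or, List.nodup_nil,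
      not_false_eq_true, and_true]
    refine ⟨⟨?_, ?_, ?_, ?_, ?_, ?_⟩, ⟨?_, ?_, ?_, ?_, ?_⟩, ⟨?_, ?_, ?_, ?_⟩, ⟨?_, ?_, ?_⟩,
      ⟨?_, ?_⟩, ?_⟩ <;> intro h <;> linarith
  obtain ⟨hD, m, hm, h0, hi⟩ := IsMinimalCage.distMatrix_even hk1 (d := 4) h hnd
    (Q := C (6 / k : ℝ) * X ^ 6 + C 5 * X ^ 5 + C ((24 - 26 * k) / k : ℝ) * X ^ 4
      - C (20 * k - 18 : ℝ) * X ^ 3 + C ((24 * (k : ℝ) ^ 2 - 44 * k + 18) / k) * X ^ 2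
      + C (15 * (k : ℝ) ^ 2 - 26 * k + 9) * X - C (2 * (k : ℝ) ^ 2 - 6 * k + 6))
    (fun x => by
      simp [Finset.sum_range_succ, eval_evenLayerPoly, eval_layerPoly_zero, eval_layerPoly_one,
        eval_layerPoly_two, eval_layerPoly_three hk1, eval_layerPoly_four hk1,
        eval_layerPoly_five hk1, eval_layerPoly_six hk1, -mul_eq_mul_left_iff]
      field_simp
      linear_combination (k ^ 2 - x ^ 2) * x * ((x ^ 2 - r ^ 2) * hs + (x ^ 2 - (k - 1)) * hr))
    (fun x => by
      simp [Finset.sum_range_succ, eval_evenLayerPoly, eval_layerPoly_zero, eval_layerPoly_one,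
        eval_layerPoly_two, eval_layerPoly_three hk1, eval_layerPoly_four hk1,
        eval_layerPoly_five hk1, eval_layerPoly_six hk1]
      field_simp
      ring)
  have e1 := hi 1 le_rfl (by norm_num)
  have e2 := hi 2 (by norm_num) (by norm_num)
  have e3 := hi 3 (by norm_num) (by norm_num)
  have e4 := hi 4 (by norm_num) (by norm_num)
  have e5 := hi 5 (by norm_num) (by norm_num)
  have e6 := hi 6 (by norm_num) le_rfl
  replace h0 := h0.trans (mooreBound_twelve hk1)
  simp only [List.map_cons, List.map_nil, List.sum_cons, List.sum_nil, eval_evenLayerPoly,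
    eval_layerPoly_zero, eval_layerPoly_one, eval_layerPoly_two, eval_layerPoly_three hk1,
    eval_layerPoly_four hk1, eval_layerPoly_five hk1, eval_layerPoly_six hk1, Nat.reduceAdd,
    Nat.reduceEqDiff, if_true, if_false, one_mul, mul_one] at h0 e1 e2 e3 e4 e5 e6
  replace e6 := congrArg ((k : ℝ) * ·) e6
  simp only [mul_add, mul_left_comm (k : ℝ) _ ((k : ℝ)⁻¹ * _), mul_inv_cancel_left₀ hk0,
    mul_zero] at e6
  obtain ⟨ma, mb, mz, mc, me, mf, mg⟩ := multiplicities_twelve hk3 hs0 hs hr0 hr (a := m k)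
    (b := m (-k)) (z := m 0) (c := m s) (e := m (-s)) (f := m r) (g := m (-r))
    (by linear_combination h0) (by linear_combination e1)
    (by linear_combination e2) (by linear_combination e3) (by linear_combination e4)
    (by linear_combination e5) (by linear_combination e6)
  have ma' : m k = 1 := by exact_mod_cast ma
  have mb' : m (-k) = 1 := by exact_mod_cast mb
  have me' : m (-s) = m s := by exact_mod_cast me.trans mc.symm
  have mg' : m (-r) = m r := by exact_mod_cast mg.trans mf.symm
  have hk4 : (0 : ℝ) < k - 1 := by linarith
  have hzpos : 0 < m 0 := by
    have : (0 : ℝ) < m 0 := by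
      rw [mz]
      positivity
    exact_mod_cast this
  have hspos : 0 < m s := by
    have : (0 : ℝ) < m s := by
      rw [mc]
      positivity
    exact_mod_cast this
  have hrpos : 0 < m r := by
    have : (0 : ℝ) < m r := by
      rw [mf]
      positivity
    exact_mod_cast this
  refine ⟨?_, m 0, m s, m r, ?_, ?_, ?_, ?_, ?_, ?_⟩
  · rw [hD]
    simp only [map_add (aeval (R := ℝ) (G.adjMatrix ℝ)), map_sub (aeval (R := ℝ) (G.adjMatrix ℝ)),
      map_mul (aeval (R := ℝ) (G.adjMatrix ℝ)), map_pow, aeval_X, aeval_C,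
      Algebra.algebraMap_eq_smul_one, smul_mul_assoc, one_mul]
  · rw [mz, hcard, eq_div_iff (mul_ne_zero three_ne_zero hk0)]
    ring
  · rw [mc, hcard, eq_div_iff (mul_ne_zero four_ne_zero hp.ne')]
    ring
  · rw [mf, hcard, eq_div_iff (mul_ne_zero (by norm_num) hp'.ne')]
    ring
  · exact nodup_twelve hk3 hs0 hs hr0 hr
  · simp [hspos, hzpos, hrpos]
  · obtain ⟨q, hq⟩ : ∃ q : ℝ → ℝ, ∀ x, q x =
        (6 * x ^ 6 + 5 * k * x ^ 5 + (24 - 26 * k) * x ^ 4 - (20 * k - 18) * k * x ^ 3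
          + (24 * k ^ 2 - 44 * k + 18) * x ^ 2 + (15 * k ^ 2 - 26 * k + 9) * k * x
          - (2 * k ^ 2 - 6 * k + 6) * k) / k := ⟨_, fun _ => rfl⟩
    have hQ : ∀ x : ℝ, (C (6 / k : ℝ) * X ^ 6 + C 5 * X ^ 5 + C ((24 - 26 * k) / k : ℝ) * X ^ 4
        - C (20 * k - 18 : ℝ) * X ^ 3 + C ((24 * (k : ℝ) ^ 2 - 44 * k + 18) / k) * X ^ 2
        + C (15 * (k : ℝ) ^ 2 - 26 * k + 9) * X
        - C (2 * (k : ℝ) ^ 2 - 6 * k + 6)).eval x = q x := by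
      intro x
      rw [hq]
      simp
      field_simp
    have hqs : ∀ x : ℝ, x ^ 2 = k - 1 → q x = 2 * (k - 2) * (k + x) := by
      intro x hx
      rw [hq, div_eq_iff hk0]
      linear_combination (6 * x ^ 4 + 5 * k * x ^ 3 + (18 - 20 * k) * x ^ 2
        + (13 * k - 15 * k ^ 2) * x + 4 * k ^ 2 - 6 * k) * hx
    have hqr : ∀ x : ℝ, x ^ 2 = 3 * (k - 1) → q x = -2 * k * (k + x) := by
      intro x hx
      rw [hq, div_eq_iff hk0]
      linear_combination (6 * x ^ 4 + 5 * k * x ^ 3 + (6 - 8 * k) * x ^ 2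
        + (3 * k - 5 * k ^ 2) * x - 2 * k) * hx
    have hq1 : q k = 11 * (k : ℝ) ^ 5 - 46 * (k : ℝ) ^ 4 + 81 * (k : ℝ) ^ 3 - 72 * (k : ℝ) ^ 2
        + 33 * k - 6 := by
      rw [hq, div_eq_iff hk0]
      ring
    have hq2 : q (-k) = (k : ℝ) ^ 5 - 6 * (k : ℝ) ^ 4 + 15 * (k : ℝ) ^ 3 - 20 * (k : ℝ) ^ 2
        + 15 * k - 6 := by
      rw [hq, div_eq_iff hk0]
      ring
    have hq0 : q 0 = -2 * (k : ℝ) ^ 2 + 6 * k - 6 := by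
      rw [hq, div_eq_iff hk0]
      ring
    rw [hm]
    simp only [List.map_cons, List.map_nil, hQ]
    rw [hq1, hq2, hq0, hqs s hs, hqs (-s) (by rw [neg_sq, hs]), hqr r hr,
      hqr (-r) (by rw [neg_sq, hr]), ma', mb', me', mg', ← sub_eq_add_neg, ← sub_eq_add_neg]

end EvenSpectra

/-! ### Girth of the named graphs -/

section Examples

open SimpleGraph

theorem SimpleGraph.five_le_egirth {V : Type u} {G : SimpleGraph V}
    (h3 : ∀ a b c, G.Adj a b → G.Adj b c → ¬ G.Adj c a)
    (h4 : ∀ a b c d, a ≠ c → b ≠ d → G.Adj a b → G.Adj b c → G.Adj c d → ¬ G.Adj d a) :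
    (5 : ℕ∞) ≤ G.egirth := by
  rw [le_egirth]
  intro a w hw
  by_contra hlt
  have hl : w.length < 5 := by exact_mod_cast not_le.1 hlt
  have hl3 := hw.three_le_length
  have hnd := hw.support_nodup
  match w, hw, hl, hl3, hnd with
  | .cons h1 (.cons h2 (.cons h3' .nil)), _, _, _, _ => exact h3 _ _ _ h1 h2 h3'
  | .cons h1 (.cons h2 (.cons h3' (.cons h4' .nil))), _, _, _, hnd =>
    simp only [Walk.support_cons, Walk.support_nil, List.tail_cons, List.nodup_cons, List.mem_cons,
      List.not_mem_nil, or_false, not_or] at hnd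
    exact h4 _ _ _ _ (Ne.symm hnd.2.1.2) hnd.1.2.1 h1 h2 h3' h4'

section Incidence

variable {P L : Type} {I : P → L → Prop}

theorem incidenceGraph_walk_even {a : P ⊕ L} (w : (incidenceGraph I).Walk a a) :
    Even w.length := by
  have c : (incidenceGraph I).Coloring Bool := Coloring.mk Sum.isLeft (by
    rintro (p | l) (q | m) h
    · exact h.elim
    · simp
    · simp
    · exact h.elim)
  exact (c.even_length_iff_congr w).2 Iff.rfl

theorem six_le_egirth_incidenceGraph
    (h4 : ∀ p q l m, p ≠ q → l ≠ m → I p l → I q l → I p m → ¬ I q m) :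
    (6 : ℕ∞) ≤ (incidenceGraph I).egirth := by
  rw [le_egirth]
  intro a w hw
  by_contra hlt
  have hl : w.length < 6 := by exact_mod_cast not_le.1 hlt
  have hl3 := hw.three_le_length
  obtain ⟨t, ht⟩ := incidenceGraph_walk_even w
  have hl4 : w.length = 4 := by omega
  have hnd := hw.support_nodup
  match w, hl4, hnd with
  | .cons (v := v1) h1 (.cons (v := v2) h2 (.cons (v := v3) h3 (.cons h4' .nil))), _, hnd =>
    simp only [Walk.support_cons, Walk.support_nil, List.tail_cons, List.nodup_cons, List.mem_cons,
      List.not_mem_nil, or_false, not_or] at hnd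
    rcases a with a | a <;> rcases v1 with v1 | v1 <;> try exact h1.elim
    all_goals rcases v2 with v2 | v2 <;> try exact h2.elim
    all_goals rcases v3 with v3 | v3 <;> try exact h3.elim
    · exact h4 a v2 v1 v3 (fun h => hnd.2.1.2 (by rw [h])) (fun h => hnd.1.2.1 (by rw [h]))
        h1 h2 h4' h3
    · exact h4 v1 v3 a v2 (fun h => hnd.1.2.1 (by rw [h])) (fun h => hnd.2.1.2 (by rw [h]))
        h1 h4' h2 h3

theorem eight_le_egirth_incidenceGraph
    (h4 : ∀ p q l m, p ≠ q → l ≠ m → I p l → I q l → I p m → ¬ I q m)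
    (h6 : ∀ p q r l m n, p ≠ q → q ≠ r → p ≠ r → l ≠ m → m ≠ n → l ≠ n →
      I p l → I q l → I q m → I r m → I r n → ¬ I p n) :
    (8 : ℕ∞) ≤ (incidenceGraph I).egirth := by
  rw [le_egirth]
  intro a w hw
  by_contra hlt
  have hl : w.length < 8 := by exact_mod_cast not_le.1 hlt
  have hl3 : 6 ≤ w.length := by
    exact_mod_cast (six_le_egirth_incidenceGraph h4).trans (egirth_le_length hw)
  obtain ⟨t, ht⟩ := incidenceGraph_walk_even w
  have hl6 : w.length = 6 := by omega
  have hnd := hw.support_nodup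
  match w, hl6, hnd with
  | .cons (v := v1) h1 (.cons (v := v2) h2 (.cons (v := v3) h3 (.cons (v := v4) h4
      (.cons (v := v5) h5 (.cons h6' .nil))))), _, hnd =>
    simp only [Walk.support_cons, Walk.support_nil, List.tail_cons, List.nodup_cons, List.mem_cons,
      List.not_mem_nil, or_false, not_or] at hnd
    obtain ⟨⟨-, n13, -, n15, -⟩, ⟨-, n24, -, n20⟩, ⟨-, n35, -⟩, ⟨-, n40⟩, -⟩ := hnd
    rcases a with a | a <;> rcases v1 with v1 | v1 <;> try exact h1.elim
    all_goals rcases v2 with v2 | v2 <;> try exact h2.elim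
    all_goals rcases v3 with v3 | v3 <;> try exact h3.elim
    all_goals rcases v4 with v4 | v4 <;> try exact h4.elim
    all_goals rcases v5 with v5 | v5 <;> try exact h5.elim
    · exact h6 a v2 v4 v1 v3 v5 (fun h => n20 (by rw [h])) (fun h => n24 (by rw [h]))
        (fun h => n40 (by rw [h])) (fun h => n13 (by rw [h])) (fun h => n35 (by rw [h]))
        (fun h => n15 (by rw [h])) h1 h2 h3 h4 h5 h6'
    · exact h6 v1 v3 v5 v2 v4 a (fun h => n13 (by rw [h])) (fun h => n35 (by rw [h]))
        (fun h => n15 (by rw [h])) (fun h => n24 (by rw [h])) (fun h => n40 (by rw [h]))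
        (fun h => n20 (by rw [h])) h2 h3 h4 h5 h6' h1

end Incidence

theorem petersenGraph_isMinimalCage : IsMinimalCage petersenGraph 3 5 := by
  have hc : Fintype.card {s : Finset (Fin 5) // s.card = 2} = 10 := by decide +kernel
  have : Nonempty {s : Finset (Fin 5) // s.card = 2} := ⟨⟨{0, 1}, rfl⟩⟩
  refine .of_le_egirth (by norm_num) (by norm_num) ?_ (five_le_egirth ?_ ?_) hc
  · unfold IsRegularOfDegree
    decide +kernel
  · have h : ∀ a b, petersenGraph.Adj a b → ∀ c, petersenGraph.Adj b c →
        ¬ petersenGraph.Adj c a := by decide +kernel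
    exact fun a b c hab => h a b hab c
  · have h : ∀ a b, petersenGraph.Adj a b → ∀ c, petersenGraph.Adj b c → a ≠ c → ∀ d, b ≠ d →
        petersenGraph.Adj c d → ¬ petersenGraph.Adj d a := by decide +kernel
    exact fun a b c d hac hbd hab hbc => h a b hab c hbc hac d hbd

set_option linter.unusedSimpArgs false in
theorem hoffmanSingletonGraph_isMinimalCage : IsMinimalCage hoffmanSingletonGraph 7 5 := by
  have hp : Fact (Nat.Prime 5) := ⟨by norm_num⟩
  refine .of_le_egirth (by norm_num) (by norm_num) ?_ (five_le_egirth ?_ ?_) ?_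
  · unfold IsRegularOfDegree
    decide +kernel
  · rintro (⟨a1, a2⟩ | ⟨a1, a2⟩) (⟨b1, b2⟩ | ⟨b1, b2⟩) (⟨c1, c2⟩ | ⟨c1, c2⟩) <;>
      simp only [hoffmanSingletonGraph, hoffmanSingletonAdj] <;> grind
  · -- A quadrangle that alternates between pentagons and pentagrams gives
    -- `(h - h') * (i - i') = 0`, and one with an edge in each would give `± 1 = ± 2`. In the other
    -- cases two opposite vertices coincide.
    rintro (⟨a1, a2⟩ | ⟨a1, a2⟩) (⟨b1, b2⟩ | ⟨b1, b2⟩) (⟨c1, c2⟩ | ⟨c1, c2⟩)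
      (⟨d1, d2⟩ | ⟨d1, d2⟩) <;>
      simp only [hoffmanSingletonGraph, hoffmanSingletonAdj, ne_eq, Sum.inl.injEq, Sum.inr.injEq,
        Prod.mk.injEq] <;> grind
  · simp [mooreBound, ZMod.card, Finset.sum_range_succ, Nat.odd_iff]

theorem heawoodGraph_isMinimalCage : IsMinimalCage heawoodGraph 3 6 := by
  refine .of_le_egirth (by norm_num) (by norm_num) ?_ (six_le_egirth_incidenceGraph ?_) ?_
  · unfold IsRegularOfDegree
    decide +kernel
  · decide +kernel
  · simp [mooreBound, ZMod.card, Finset.sum_range_succ, Nat.odd_iff]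

section Levi

variable {s t r : Finset (Fin 6)} {σ τ : Equiv.Perm (Fin 6)}

theorem apply_eq_of_image_eq (hs : s.card = 2) (hσ : ∀ x, σ x ≠ x) (hτ : ∀ x, τ x ≠ x)
    (h1 : s.image σ = s) (h2 : s.image τ = s) {x : Fin 6} (hx : x ∈ s) : σ x = τ x := by
  have hσx : σ x ∈ s := h1 ▸ Finset.mem_image_of_mem σ hx
  have hτx : τ x ∈ s := h2 ▸ Finset.mem_image_of_mem τ hx
  rw [Finset.card_eq_two] at hs
  obtain ⟨a, b, -, rfl⟩ := hs
  have h3 := hσ x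
  have h4 := hτ x
  simp only [Finset.mem_insert, Finset.mem_singleton] at hx hσx hτx
  grind

/-- Two pairs of a partition into pairs are equal or disjoint. -/
theorem disjoint_of_image_eq (hs : s.card = 2) (ht : t.card = 2) (hst : s ≠ t)
    (hσ : ∀ x, σ x ≠ x) (h1 : s.image σ = s) (h2 : t.image σ = t) : Disjoint s t := by
  have key : ∀ u : Finset (Fin 6), u.card = 2 → u.image σ = u → ∀ x ∈ u, u = {x, σ x} := by
    intro u hu h x hx
    symm
    apply Finset.eq_of_subset_of_card_le
    · intro y hy
      simp only [Finset.mem_insert, Finset.mem_singleton] at hy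
      rcases hy with rfl | rfl
      · exact hx
      · exact h ▸ Finset.mem_image_of_mem σ hx
    · rw [hu, Finset.card_pair (hσ x).symm]
  rw [Finset.disjoint_left]
  intro x hxs hxt
  exact hst ((key s hs h1 x hxs).trans (key t ht h2 x hxt).symm)

/-- The third pair of a partition into pairs is the complement of the other two. -/
theorem image_compl_union_eq (h1 : s.image σ = s) (h2 : t.image σ = t) :
    ((s ∪ t)ᶜ).image σ = (s ∪ t)ᶜ := by
  have h3 : ((s ∪ t)ᶜ).image σ = ((s ∪ t).image σ)ᶜ := by
    exact_mod_cast Set.image_compl_eq (s := ((s ∪ t : Finset (Fin 6)) : Set (Fin 6))) σ.bijective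
  rw [h3, Finset.image_union, h1, h2]

theorem eq_of_image_eq (hs : s.card = 2) (ht : t.card = 2) (hst : s ≠ t)
    (hσ : ∀ x, σ x ≠ x) (hτ : ∀ x, τ x ≠ x) (h1 : s.image σ = s) (h2 : t.image σ = t)
    (h3 : s.image τ = s) (h4 : t.image τ = t) : σ = τ := by
  have hd := disjoint_of_image_eq hs ht hst hσ h1 h2
  ext x : 1
  by_cases hx : x ∈ s
  · exact apply_eq_of_image_eq hs hσ hτ h1 h3 hx
  by_cases hx' : x ∈ t
  · exact apply_eq_of_image_eq ht hσ hτ h2 h4 hx'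
  · refine apply_eq_of_image_eq (s := (s ∪ t)ᶜ) ?_ hσ hτ (image_compl_union_eq h1 h2)
      (image_compl_union_eq h3 h4) (by simp [hx, hx'])
    rw [Finset.card_compl, Finset.card_union_of_disjoint hd, hs, ht, Fintype.card_fin]

theorem leviGraph_isMinimalCage : IsMinimalCage leviGraph 3 8 := by
  have : Nonempty {s : Finset (Fin 6) // s.card = 2} := ⟨⟨{0, 1}, rfl⟩⟩
  have hP : Fintype.card {s : Finset (Fin 6) // s.card = 2} = 15 := by decide +kernel
  have hL : Fintype.card {σ : Equiv.Perm (Fin 6) // ∀ x, σ x ≠ x ∧ σ (σ x) = x} = 15 := by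
    decide +kernel
  refine .of_le_egirth (by norm_num) (by norm_num) ?_ (eight_le_egirth_incidenceGraph ?_ ?_) ?_
  · unfold IsRegularOfDegree
    decide +kernel
  · rintro ⟨p, hp⟩ ⟨q, hq⟩ ⟨l, hl⟩ ⟨m, hm⟩ hpq hlm h1 h2 h3 h4
    exact hlm (Subtype.ext (eq_of_image_eq hp hq (fun h => hpq (Subtype.ext h))
      (fun x => (hl x).1) (fun x => (hm x).1) h1 h2 h3 h4))
  · -- Three pairwise disjoint pairs partition the `6`-set, so that the first line of a triangle
    -- passes through its third point as well.
    rintro ⟨p, hp⟩ ⟨q, hq⟩ ⟨r, hr⟩ ⟨l, hl⟩ ⟨m, hm⟩ ⟨n, hn⟩ hpq hqr hpr hlm _ _ h1 h2 h3 h4 h5 h6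
    have hpq' : p ≠ q := fun h => hpq (Subtype.ext h)
    have hqr' : q ≠ r := fun h => hqr (Subtype.ext h)
    have hpr' : p ≠ r := fun h => hpr (Subtype.ext h)
    have d1 := disjoint_of_image_eq hp hq hpq' (fun x => (hl x).1) h1 h2
    have d2 := disjoint_of_image_eq hq hr hqr' (fun x => (hm x).1) h3 h4
    have d3 := disjoint_of_image_eq hp hr hpr' (fun x => (hn x).1) h6 h5
    have hr' : r = (p ∪ q)ᶜ := by
      apply Finset.eq_of_subset_of_card_le
      · rw [Finset.subset_compl_iff_disjoint_left, Finset.disjoint_union_left]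
        exact ⟨d3, d2⟩
      · rw [Finset.card_compl, Finset.card_union_of_disjoint d1, hp, hq, hr, Fintype.card_fin]
    have h7 : r.image l = r := hr' ▸ image_compl_union_eq h1 h2
    exact hlm (Subtype.ext (eq_of_image_eq hq hr hqr' (fun x => (hl x).1) (fun x => (hm x).1)
      h2 h7 h3 h4))
  · rw [Fintype.card_sum, hP, hL]
    simp [mooreBound, Finset.sum_range_succ, Nat.odd_iff]

end Levi

end Examples

/-! ### Small degrees and named graphs -/

section SmallDegrees

variable {V : Type u} [Fintype V] [DecidableEq V] {G : SimpleGraph V} [DecidableRel G.Adj]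

theorem IsMinimalCage.distance_three_five (h : IsMinimalCage G 3 5) :
    distMatrix G = -(6 : ℝ) • 1 + G.adjMatrix ℝ + (2 : ℝ) • G.adjMatrix ℝ ^ 2 ∧
      HasDistanceSpectrum G [(15, 1), (-3, 5), (0, 4)] := by
  have h1 := h.distMatrix_five
  have h2 := h.spectrum_five (r := 1) (s := -2) (b := 5) (c := 4) (by norm_num) (by norm_num)
    (by norm_num) (by norm_num) (by norm_num) (by norm_num) (by norm_num) (by norm_num)
  norm_num at h1 h2 ⊢
  exact ⟨h1, h2⟩

theorem IsMinimalCage.distance_seven_five (h : IsMinimalCage G 7 5) :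
    distMatrix G = -(14 : ℝ) • 1 + G.adjMatrix ℝ + (2 : ℝ) • G.adjMatrix ℝ ^ 2 ∧
      HasDistanceSpectrum G [(91, 1), (-4, 28), (1, 21)] := by
  have h1 := h.distMatrix_five
  have h2 := h.spectrum_five (r := 2) (s := -3) (b := 28) (c := 21) (by norm_num) (by norm_num)
    (by norm_num) (by norm_num) (by norm_num) (by norm_num) (by norm_num) (by norm_num)
  norm_num at h1 h2 ⊢
  exact ⟨h1, h2⟩

theorem IsMinimalCage.distance_fiftySeven_five (h : IsMinimalCage G 57 5) :
    distMatrix G = -(114 : ℝ) • 1 + G.adjMatrix ℝ + (2 : ℝ) • G.adjMatrix ℝ ^ 2 ∧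
      HasDistanceSpectrum G [(6441, 1), (-9, 1729), (6, 1520)] := by
  have h1 := h.distMatrix_five
  have h2 := h.spectrum_five (r := 7) (s := -8) (b := 1729) (c := 1520) (by norm_num) (by norm_num)
    (by norm_num) (by norm_num) (by norm_num) (by norm_num) (by norm_num) (by norm_num)
  norm_num at h1 h2 ⊢
  exact ⟨h1, h2⟩

theorem heawoodGraph_distance :
    distMatrix heawoodGraph =
        heawoodGraph.adjMatrix ℝ ^ 3 + (2 : ℝ) • heawoodGraph.adjMatrix ℝ ^ 2
          - (4 : ℝ) • heawoodGraph.adjMatrix ℝ - (6 : ℝ) • 1 ∧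
      HasDistanceSpectrum heawoodGraph
        [(27, 1), (-3, 1), (-2 * (1 + Real.sqrt 2), 6), (-2 * (1 - Real.sqrt 2), 6)] := by
  obtain ⟨h1, m, hm, h2⟩ := heawoodGraph_isMinimalCage.spectrum_six le_rfl
  have hm' : m = 6 := by
    have : (m : ℝ) = 6 := by
      rw [hm]
      simp [ZMod.card]
      norm_num
    exact_mod_cast this
  subst hm'
  constructor
  · rw [h1]
    norm_num
  · convert h2 using 4 <;> norm_num

theorem leviGraph_distance :
    distMatrix leviGraph =
        (4 / 3 : ℝ) • leviGraph.adjMatrix ℝ ^ 4 + (3 : ℝ) • leviGraph.adjMatrix ℝ ^ 3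
          - (22 / 3 : ℝ) • leviGraph.adjMatrix ℝ ^ 2 - (14 : ℝ) • leviGraph.adjMatrix ℝ
          + (2 : ℝ) • 1 ∧
      HasDistanceSpectrum leviGraph [(83, 1), (5, 1), (2, 10), (-10, 9), (-2, 9)] := by
  obtain ⟨h1, m₀, m₁, hm₀, hm₁, h2⟩ := leviGraph_isMinimalCage.spectrum_eight le_rfl
  have hc : (Fintype.card ({s : Finset (Fin 6) // s.card = 2} ⊕
      {σ : Equiv.Perm (Fin 6) // ∀ x, σ x ≠ x ∧ σ (σ x) = x}) : ℝ) = 30 := by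
    rw [leviGraph_isMinimalCage.card_eq, mooreBound_eight (by norm_num)]
    norm_num
  rw [hc] at hm₀ hm₁
  have hm₀' : m₀ = 10 := by
    have : (m₀ : ℝ) = 10 := by
      rw [hm₀]
      norm_num
    exact_mod_cast this
  have hm₁' : m₁ = 9 := by
    have : (m₁ : ℝ) = 9 := by
      rw [hm₁]
      norm_num
    exact_mod_cast this
  subst hm₀' hm₁'
  have h4 : Real.sqrt (2 * ((3 : ℕ) - 1)) = 2 := by
    rw [show (2 * (((3 : ℕ) : ℝ) - 1)) = 2 ^ 2 by norm_num]
    exact Real.sqrt_sq (by norm_num)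
  rw [h4] at h2
  constructor
  · rw [h1]
    norm_num
    module
  · convert h2 using 4 <;> norm_num

end SmallDegrees

theorem mainTheorem5 :
    -- minimal `(k, 5)`-cages
    (∀ (V : Type u) [Fintype V] [DecidableEq V] (G : SimpleGraph V) [DecidableRel G.Adj] (k : ℕ),
      3 ≤ k → IsMinimalCage G k 5 →
        distMatrix G = -(2 * k : ℝ) • 1 + G.adjMatrix ℝ + (2 : ℝ) • G.adjMatrix ℝ ^ 2) ∧
    -- minimal `(3, 5)`-cages
    (∀ (V : Type u) [Fintype V] [DecidableEq V] (G : SimpleGraph V) [DecidableRel G.Adj],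
      IsMinimalCage G 3 5 →
        distMatrix G = -(6 : ℝ) • 1 + G.adjMatrix ℝ + (2 : ℝ) • G.adjMatrix ℝ ^ 2 ∧
        HasDistanceSpectrum G [(15, 1), (-3, 5), (0, 4)]) ∧
    -- the Petersen graph
    (IsMinimalCage petersenGraph 3 5 ∧
      distMatrix petersenGraph =
        -(6 : ℝ) • 1 + petersenGraph.adjMatrix ℝ + (2 : ℝ) • petersenGraph.adjMatrix ℝ ^ 2 ∧
      HasDistanceSpectrum petersenGraph [(15, 1), (-3, 5), (0, 4)]) ∧
    -- minimal `(7, 5)`-cages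
    (∀ (V : Type u) [Fintype V] [DecidableEq V] (G : SimpleGraph V) [DecidableRel G.Adj],
      IsMinimalCage G 7 5 →
        distMatrix G = -(14 : ℝ) • 1 + G.adjMatrix ℝ + (2 : ℝ) • G.adjMatrix ℝ ^ 2 ∧
        HasDistanceSpectrum G [(91, 1), (-4, 28), (1, 21)]) ∧
    -- the Hoffman–Singleton graph
    (IsMinimalCage hoffmanSingletonGraph 7 5 ∧
      distMatrix hoffmanSingletonGraph =
        -(14 : ℝ) • 1 + hoffmanSingletonGraph.adjMatrix ℝ +
          (2 : ℝ) • hoffmanSingletonGraph.adjMatrix ℝ ^ 2 ∧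
      HasDistanceSpectrum hoffmanSingletonGraph [(91, 1), (-4, 28), (1, 21)]) ∧
    -- minimal `(57, 5)`-cages
    (∀ (V : Type u) [Fintype V] [DecidableEq V] (G : SimpleGraph V) [DecidableRel G.Adj],
      IsMinimalCage G 57 5 →
        distMatrix G = -(114 : ℝ) • 1 + G.adjMatrix ℝ + (2 : ℝ) • G.adjMatrix ℝ ^ 2 ∧
        HasDistanceSpectrum G [(6441, 1), (-9, 1729), (6, 1520)]) ∧
    -- minimal `(k, 6)`-cages
    (∀ (V : Type u) [Fintype V] [DecidableEq V] (G : SimpleGraph V) [DecidableRel G.Adj] (k : ℕ),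
      3 ≤ k → IsMinimalCage G k 6 →
        distMatrix G =
          (3 / k : ℝ) • G.adjMatrix ℝ ^ 3 + (2 : ℝ) • G.adjMatrix ℝ ^ 2
            - ((5 * k - 3) / k : ℝ) • G.adjMatrix ℝ - (2 * k : ℝ) • 1 ∧
        ∃ m : ℕ,
          (m : ℝ) = Fintype.card V * k * (k - 1) / (2 * ((k : ℝ) ^ 2 - k + 1)) ∧
          HasDistanceSpectrum G
            [(5 * (k : ℝ) ^ 2 - 7 * k + 3, 1),
             (-(k : ℝ) ^ 2 + 3 * k - 3, 1),
             (-2 * (1 + Real.sqrt (k - 1)), m),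
             (-2 * (1 - Real.sqrt (k - 1)), m)]) ∧
    -- the Heawood graph
    (IsMinimalCage heawoodGraph 3 6 ∧
      distMatrix heawoodGraph =
        heawoodGraph.adjMatrix ℝ ^ 3 + (2 : ℝ) • heawoodGraph.adjMatrix ℝ ^ 2
          - (4 : ℝ) • heawoodGraph.adjMatrix ℝ - (6 : ℝ) • 1 ∧
      HasDistanceSpectrum heawoodGraph
        [(27, 1), (-3, 1), (-2 * (1 + Real.sqrt 2), 6), (-2 * (1 - Real.sqrt 2), 6)]) ∧
    -- minimal `(k, 8)`-cages
    (∀ (V : Type u) [Fintype V] [DecidableEq V] (G : SimpleGraph V) [DecidableRel G.Adj] (k : ℕ),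
      3 ≤ k → IsMinimalCage G k 8 →
        distMatrix G =
          (4 / k : ℝ) • G.adjMatrix ℝ ^ 4 + (3 : ℝ) • G.adjMatrix ℝ ^ 3
            + ((8 - 10 * k) / k : ℝ) • G.adjMatrix ℝ ^ 2 - (6 * k - 4 : ℝ) • G.adjMatrix ℝ
            + (2 * k - 4 : ℝ) • 1 ∧
        ∃ m₀ m₁ : ℕ,
          (m₀ : ℝ) = Fintype.card V * (k - 1) / (2 * (k : ℝ)) ∧
          (m₁ : ℝ) = Fintype.card V * k * (k - 1) / (4 * ((k : ℝ) ^ 2 - 2 * k + 2)) ∧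
          HasDistanceSpectrum G
            [(7 * (k : ℝ) ^ 3 - 16 * (k : ℝ) ^ 2 + 14 * k - 4, 1),
             ((k : ℝ) ^ 3 - 4 * (k : ℝ) ^ 2 + 6 * k - 4, 1),
             (2 * (k : ℝ) - 4, m₀),
             (-2 * (k + Real.sqrt (2 * (k - 1))), m₁),
             (-2 * (k - Real.sqrt (2 * (k - 1))), m₁)]) ∧
    -- the Levi graph
    (IsMinimalCage leviGraph 3 8 ∧
      distMatrix leviGraph =
        (4 / 3 : ℝ) • leviGraph.adjMatrix ℝ ^ 4 + (3 : ℝ) • leviGraph.adjMatrix ℝ ^ 3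
          - (22 / 3 : ℝ) • leviGraph.adjMatrix ℝ ^ 2 - (14 : ℝ) • leviGraph.adjMatrix ℝ
          + (2 : ℝ) • 1 ∧
      HasDistanceSpectrum leviGraph [(83, 1), (5, 1), (2, 10), (-10, 9), (-2, 9)]) ∧
    -- minimal `(k, 12)`-cages
    (∀ (V : Type u) [Fintype V] [DecidableEq V] (G : SimpleGraph V) [DecidableRel G.Adj] (k : ℕ),
      3 ≤ k → IsMinimalCage G k 12 →
        distMatrix G =
          (6 / k : ℝ) • G.adjMatrix ℝ ^ 6 + (5 : ℝ) • G.adjMatrix ℝ ^ 5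
            + ((24 - 26 * k) / k : ℝ) • G.adjMatrix ℝ ^ 4
            - (20 * k - 18 : ℝ) • G.adjMatrix ℝ ^ 3
            + ((24 * (k : ℝ) ^ 2 - 44 * k + 18) / k) • G.adjMatrix ℝ ^ 2
            + (15 * (k : ℝ) ^ 2 - 26 * k + 9) • G.adjMatrix ℝ
            - (2 * (k : ℝ) ^ 2 - 6 * k + 6) • 1 ∧
        ∃ m₀ m₁ m₂ : ℕ,
          (m₀ : ℝ) = Fintype.card V * (k - 1) / (3 * (k : ℝ)) ∧
          (m₁ : ℝ) = Fintype.card V * k * (k - 1) / (4 * ((k : ℝ) ^ 2 - k + 1)) ∧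
          (m₂ : ℝ) = Fintype.card V * k * (k - 1) / (12 * ((k : ℝ) ^ 2 - 3 * k + 3)) ∧
          HasDistanceSpectrum G
            [(11 * (k : ℝ) ^ 5 - 46 * (k : ℝ) ^ 4 + 81 * (k : ℝ) ^ 3 - 72 * (k : ℝ) ^ 2
                + 33 * k - 6, 1),
             ((k : ℝ) ^ 5 - 6 * (k : ℝ) ^ 4 + 15 * (k : ℝ) ^ 3 - 20 * (k : ℝ) ^ 2
                + 15 * k - 6, 1),
             (-2 * (k : ℝ) ^ 2 + 6 * k - 6, m₀),
             (2 * (k - 2) * (k + Real.sqrt (k - 1)), m₁),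
             (2 * (k - 2) * (k - Real.sqrt (k - 1)), m₁),
             (-2 * k * (k + Real.sqrt (3 * (k - 1))), m₂),
             (-2 * k * (k - Real.sqrt (3 * (k - 1))), m₂)]) :=
  ⟨fun _ _ _ _ _ _ _ h => h.distMatrix_five, fun _ _ _ _ _ h => h.distance_three_five,
    ⟨petersenGraph_isMinimalCage, petersenGraph_isMinimalCage.distance_three_five⟩,
    fun _ _ _ _ _ h => h.distance_seven_five,
    ⟨hoffmanSingletonGraph_isMinimalCage, hoffmanSingletonGraph_isMinimalCage.distance_seven_five⟩,
    fun _ _ _ _ _ h => h.distance_fiftySeven_five, fun _ _ _ _ _ _ hk h => h.spectrum_six hk,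
    ⟨heawoodGraph_isMinimalCage, heawoodGraph_distance⟩,
    fun _ _ _ _ _ _ hk h => h.spectrum_eight hk, ⟨leviGraph_isMinimalCage, leviGraph_distance⟩,
    fun _ _ _ _ _ _ hk h => h.spectrum_twelve hk⟩
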